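/- Let $\mathcal M(\Lambda)$ be the set of probability measures on $\Lambda=\{-1,1,2\}$, written as triples $(q,p_1,p_2)$ of weights of the jumps $-1,1,2$, and let $\Omega=\mathcal M(\Lambda)^{\mathbb Z}$ carry the product $\sigma$-algebra. Let $P$ be a probability measure on $\Omega$ that is stationary and ergodic for the shift $(\theta\omega)_n=\omega_{n+1}$, and assume that there is $\varepsilon>0$ such that, $P$-a.s., $q(0)>0$ and $p_z(0)/q(0)\ge\varepsilon$ for $z=1,2$, where $(q(x),p_1(x),p_2(x))=\omega_x$. For $k\in\mathbb Z$ let $P^k_\omega$ be the law of the Markov chain $(X_n)_{n\ge0}$ on $\mathbb Z$ with $X_0=k$ that jumps from $x$ to $x-1,x+1,x+2$ with probabilities $q(x),p_1(x),p_2(x)$; put $P_\omega=P_\omega^0$, and let $\mathbb P(F\times G)=\int_F P_\omega(G)\,P(d\omega)$ be the annealed law. Let $T_1=\inf\{n>0: X_n>X_0\}$. For $i\le 0$ let $A(i),B(i),C(i)$ be the numbers of steps of the walk from $i$ to $i-1$ before time $T_1$ for which the next step that leads back from $(-\infty,i-1]$ to $[i,\infty)$ occurs not later than $T_1$ and is a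 jump $i-1\to i$, $i-2\to i$, $i-1\to i+1$, respectively, and let $U(i)=[A(i),B(i),C(i)]$. Let $U(1)=[1,0,0]$, $[0,1,0]$ or $[0,0,1]$ according as the step ending at time $T_1$ is $0\to1$, $-1\to1$ or $0\to2$. For $j=1,2$ let $P^{i}_\omega[(-\infty,i),i+j]$ be the $P^i_\omega$-probability that the walk reaches $[i+1,\infty)$, and does so for the first time at the point $i+j$. Put $$\gamma(i)=q(i)\,P^{i-1}_\omega[(-\infty,i-1),i+1],$$ $$\alpha(i)=q(i)\,P^{i-1}_\omega[(-\infty,i-1),i]\,\frac{p_1(i-1)}{p_1(i-1)+\gamma(i-1)},\qquad \beta(i)=q(i)\,P^{i-1}_\omega[(-\infty,i-1),i]\,\frac{\gamma(i-1)}{p_1(i-1)+\gamma(i-1)}.$$ **Theorem 1.1.** Assume $X_n\to\infty$ $\mathbb P$-a.s. Then for $P$-a.e. $\omega$ the following hold. (a) $T_1<\infty$ $P_\omega$-a.s., and under $P_\omega$ the sequence $U(1),U(0),U(-1),\dots$ is an inhomogeneous three-type branching process: given $U(1),\dots,U(i+1)$ $(i\le0)$, $U(i)$ is distributed as a sum of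 independent offspring vectors, one for each individual of $U(i+1)$. The initial generation consists of one immigrant, with $$P_\omega(U(1)=[1,0,0])=\frac{p_1(0)}{1-\alpha(0)-\beta(0)},\quad P_\omega(U(1)=[0,1,0])=\frac{\gamma(0)}{1-\alpha(0)-\beta(0)},\quad P_\omega(U(1)=[0,0,1])=\frac{p_2(0)}{1-\alpha(0)-\beta(0)},$$ and the offspring laws are, for $i\le 0$ and integers $a,b\ge0$, $$P_\omega\big(U(i)=[a,b,0]\,\big|\,U(i+1)=[1,0,0]\big)=[1-\alpha(i)-\beta(i)]\tbinom{a+b}{a}\alpha(i)^a\beta(i)^b,$$ $$P_\omega\big(U(i)=[a,b,1]\,\big|\,U(i+1)=[0,1,0]\big)=[1-\alpha(i)-\beta(i)]\tbinom{a+b}{a}\alpha(i)^a\beta(i)^b,$$ $$P_\omega\big(U(i)=[a,b,0]\,\big|\,U(i+1)=[0,0,1]\big)=[1-\alpha(i)-\beta(i)]\tbinom{a+b}{a}\alpha(i)^a\beta(i)^b.$$ (b) For every $i\in\mathbb Z$ and $n\ge0$ let $P^i_\omega[(i-n,i),i+j]$ be the probability, starting at $i$, that the walk reaches $(i,\infty)$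 before $(-\infty,i-n)$, and at the point $i+j$. With $$M(k)=\begin{pmatrix}\frac{p_1(k)+p_2(k)}{q(k)}&\frac{p_2(k)}{q(k)}\\1&0\end{pmatrix},\qquad S_n(i)=\sum_{m=0}^{n}M(i-m)M(i-m+1)\cdots M(i),$$ and $e_1=(1,0)'$, $e_2=(0,1)'$, $$P^i_\omega[(i-n,i),i+1]=\frac{\langle e_1,S_n(i)(e_1-e_2)\rangle}{1+\langle e_1,S_n(i)e_1\rangle},\qquad P^i_\omega[(i-n,i),i+2]=\frac{\langle e_1,S_n(i)e_2\rangle}{1+\langle e_1,S_n(i)e_1\rangle}.$$ As $n\to\infty$ these converge to $P^i_\omega[(-\infty,i),i+1]$ and $P^i_\omega[(-\infty,i),i+2]$, and the two limits add up to $1$. -/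

import Mathlib

open MeasureTheory ProbabilityTheory Filter
open scoped Topology

namespace RWRE

/-! ### Environments -/

/-- The set of probability measures on the three jumps `-1, 1, 2`, as triples of nonnegative weights
with sum one (in this order). -/
abbrev JumpLaw : Type := stdSimplex ℝ (Fin 3)

/-- Environments `ω = (ω_x)_{x ∈ ℤ}`, with the product `σ`-algebra. -/
abbrev Env : Type := ℤ → JumpLaw

/-- The spatial shift `(θω)_x = ω_{x+1}`. -/
def shift (ω : Env) : Env := fun x => ω (x + 1)

/-- Probability of the jump `-1` at site `x`. -/
def q (ω : Env) (x : ℤ) : ℝ := (ω x).1 0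

/-- Probability of the jump `+1` at site `x`. -/
def p₁ (ω : Env) (x : ℤ) : ℝ := (ω x).1 1

/-- Probability of the jump `+2` at site `x`. -/
def p₂ (ω : Env) (x : ℤ) : ℝ := (ω x).1 2

/-! ### The quenched and the annealed law of the walk -/

/-- Paths of the walk, with the product `σ`-algebra. -/
abbrev WalkPath : Type := ℕ → ℤ

/-- Law of the next position of a walk that sits at `x`. -/
noncomputable def stepLaw (ω : Env) (x : ℤ) : Measure ℤ :=
  ENNReal.ofReal (q ω x) • Measure.dirac (x - 1)
    + ENNReal.ofReal (p₁ ω x) • Measure.dirac (x + 1)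
    + ENNReal.ofReal (p₂ ω x) • Measure.dirac (x + 2)

instance (ω : Env) (x : ℤ) : IsProbabilityMeasure (stepLaw ω x) where
  measure_univ := by
    have h0 := (ω x).2.1
    have h1 := (ω x).2.2
    simp only [Fin.sum_univ_three] at h1
    simp only [stepLaw, Measure.coe_add, Measure.coe_smul, Pi.add_apply, Pi.smul_apply,
      measure_univ, smul_eq_mul, mul_one, q, p₁, p₂]
    rw [← ENNReal.ofReal_add (h0 0) (h0 1), ← ENNReal.ofReal_add (add_nonneg (h0 0) (h0 1)) (h0 2),
      ← ENNReal.ofReal_one]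
    exact congrArg _ h1

/-- The one-step transition kernel; the next position depends on the past only through the current
position. -/
noncomputable def stepKernel (ω : Env) (n : ℕ) : Kernel ((i : Finset.Iic n) → ℤ) ℤ :=
  Kernel.ofFunOfCountable fun y => stepLaw ω (y ⟨n, Finset.mem_Iic.2 le_rfl⟩)

instance (ω : Env) (n : ℕ) : IsMarkovKernel (stepKernel ω n) where
  isProbabilityMeasure y := by
    change IsProbabilityMeasure (stepLaw ω _)
    infer_instance

/-- The quenched law `P_ω^k`: the law on paths of the Markov chain in the environment `ω` that
starts at `k`. -/
noncomputable def quenched (ω : Env) (k : ℤ) : Measure WalkPath :=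
  Kernel.trajMeasure (X := fun _ => ℤ) (Measure.dirac k) (stepKernel ω)

instance (ω : Env) (k : ℤ) : IsProbabilityMeasure (quenched ω k) := by
  unfold quenched; infer_instance

/-- The probability that the chain follows `y` for one more step. -/
theorem quenched_cylinder_succ (ω : Env) (k : ℤ) (n : ℕ) (y : WalkPath) :
    quenched ω k {x | ∀ m ≤ n + 1, x m = y m}
      = quenched ω k {x | ∀ m ≤ n, x m = y m} * stepLaw ω (y n) {y (n + 1)} := by
  have h := Kernel.map_frestrictLe_trajMeasure_compProd_eq_map_trajMeasure
    (X := fun _ => ℤ) (κ := stepKernel ω) (μ₀ := Measure.dirac k) (a := n)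
  have h2 := congrArg
    (fun μ => μ ({Preorder.frestrictLe n y} ×ˢ {y (n + 1)})) h
  rw [Measure.compProd_apply_prod (measurableSet_singleton _) (measurableSet_singleton _),
    lintegral_singleton, Measure.map_apply (by fun_prop) (measurableSet_singleton _),
    Measure.map_apply (by fun_prop)
      ((measurableSet_singleton _).prod (measurableSet_singleton _))] at h2
  have hA : (Preorder.frestrictLe (π := fun _ => ℤ) n) ⁻¹' {Preorder.frestrictLe n y}
      = {x : WalkPath | ∀ m ≤ n, x m = y m} := by
    ext x
    simp [funext_iff]
  have hB : (fun x : WalkPath => (Preorder.frestrictLe (π := fun _ => ℤ) n x, x (n + 1))) ⁻¹'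
      ({Preorder.frestrictLe n y} ×ˢ {y (n + 1)}) = {x : WalkPath | ∀ m ≤ n + 1, x m = y m} := by
    ext x
    simp only [Set.mem_preimage, Set.mem_prod, Set.mem_singleton_iff, Set.mem_ofPred_eq,
      Nat.le_succ_iff]
    simp only [funext_iff, Preorder.frestrictLe_apply, Subtype.forall, Finset.mem_Iic]
    constructor
    · rintro ⟨h, h'⟩ m (hm | rfl)
      · exact h m hm
      · exact h'
    · exact fun h => ⟨fun m hm => h m (.inl hm), h _ (.inr rfl)⟩
  rw [hA] at h2
  erw [hB] at h2
  rw [mul_comm] at h2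
  exact h2.symm

/-- The chain starts at `k`. -/
theorem quenched_cylinder_zero (ω : Env) (k : ℤ) (y : WalkPath) :
    quenched ω k {x | ∀ m ≤ 0, x m = y m} = Measure.dirac k {y 0} := by
  have hA : (Preorder.frestrictLe (π := fun _ => ℤ) 0) ⁻¹' {Preorder.frestrictLe 0 y}
      = {x : WalkPath | ∀ m ≤ 0, x m = y m} := by
    ext x
    simp [funext_iff]
  rw [← hA, ← Measure.map_apply (by fun_prop) (measurableSet_singleton _), quenched,
    Kernel.trajMeasure, Measure.map_comp _ _ (by fun_prop), Kernel.traj_map_frestrictLe,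
    Kernel.partialTraj_self, Measure.id_comp,
    Measure.map_apply (by fun_prop) (measurableSet_singleton _)]
  congr 1
  ext z
  simp only [Set.mem_preimage, Set.mem_singleton_iff]
  rw [MeasurableEquiv.symm_apply_eq]
  rfl

theorem measurable_stepLaw (x : ℤ) (s : Set ℤ) : Measurable fun ω : Env => stepLaw ω x s := by
  simp only [stepLaw, Measure.coe_add, Measure.coe_smul, Pi.add_apply, Pi.smul_apply,
    smul_eq_mul, q, p₁, p₂]
  have h (j : Fin 3) : Measurable fun ω : Env => (ω x).1 j :=
    (measurable_pi_apply j).comp (measurable_subtype_coe.comp (measurable_pi_apply x))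
  exact (((h 0).ennreal_ofReal.mul_const _).add ((h 1).ennreal_ofReal.mul_const _)).add
    ((h 2).ennreal_ofReal.mul_const _)

theorem measurable_quenched_cylinder (k : ℤ) (n : ℕ) (y : WalkPath) :
    Measurable fun ω : Env => quenched ω k {x | ∀ m ≤ n, x m = y m} := by
  induction n with
  | zero => simp only [quenched_cylinder_zero]; exact measurable_const
  | succ n ih =>
    simp only [quenched_cylinder_succ]
    exact ih.mul (measurable_stepLaw _ _)

theorem measurable_quenched (k : ℤ) : Measurable fun ω : Env => quenched ω k := by
  refine Measurable.measure_of_isPiSystem_of_isProbabilityMeasure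
    (generateFrom_measurableCylinders (α := fun _ : ℕ => ℤ)).symm isPiSystem_measurableCylinders ?_
  intro s hs
  rw [measurableCylinders_nat] at hs
  simp only [Set.mem_iUnion, Set.mem_singleton_iff] at hs
  obtain ⟨n, S, hS, rfl⟩ := hs
  have h (ω : Env) : quenched ω k (cylinder (Finset.Iic n) S)
      = ∑' z, S.indicator (fun z =>
        quenched ω k {x | ∀ m ≤ n, x m = (if hm : m ∈ Finset.Iic n then z ⟨m, hm⟩ else 0)}) z := by
    have : quenched ω k (cylinder (Finset.Iic n) S)
        = (quenched ω k).map (Preorder.frestrictLe (π := fun _ => ℤ) n) S := by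
      rw [Measure.map_apply (by fun_prop) hS]; rfl
    rw [this, ← Measure.tsum_indicator_apply_singleton _ S hS]
    congr 1 with z
    congr 2 with z
    rw [Measure.map_apply (by fun_prop) (measurableSet_singleton _)]
    congr 1
    ext x
    simp only [Set.mem_preimage, Set.mem_singleton_iff, funext_iff, Preorder.frestrictLe_apply,
      Subtype.forall, Set.mem_ofPred_eq]
    refine forall_congr' fun m => ?_
    simp only [Finset.mem_Iic]
    refine forall_congr' fun hm => ?_
    simp [hm]
  simp only [h]
  refine Measurable.tsum fun z => ?_
  by_cases hz : z ∈ S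
  · simp only [Set.indicator_of_mem hz]
    exact measurable_quenched_cylinder k n _
  · simp only [Set.indicator_of_notMem hz]
    exact measurable_const

/-- The quenched law of the walk started at `0`, as a kernel from environments to paths. -/
noncomputable def quenchedKernel : Kernel Env WalkPath where
  toFun ω := quenched ω 0
  measurable' := measurable_quenched 0

instance : IsMarkovKernel quenchedKernel where
  isProbabilityMeasure ω := by
    change IsProbabilityMeasure (quenched ω 0)
    infer_instance

/-- The annealed law `P ⊗ P_ω` on environments and paths. -/
noncomputable def annealed (P : Measure Env) : Measure (Env × WalkPath) :=
  P ⊗ₘ quenchedKernel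

/-! ### Exit probabilities -/

/-- `P_ω^k[(-∞, b), y]` for `y > b`: the probability, starting at `k`, that the walk reaches
`(b, ∞)`, and does so for the first time at the point `y`. -/
noncomputable def exitProb (ω : Env) (k b y : ℤ) : ℝ :=
  (quenched ω k).real {x | ∃ n, x n = y ∧ ∀ m < n, x m ≤ b}

/-- `P_ω^k[(a, b), y]` for `y > b`: the probability, starting at `k`, that the walk reaches
`(b, ∞)` before `(-∞, a)`, and at the point `y`. -/
noncomputable def exitProbBefore (ω : Env) (k a b y : ℤ) : ℝ :=
  (quenched ω k).real {x | ∃ n, x n = y ∧ ∀ m < n, a ≤ x m ∧ x m ≤ b}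

/-- The matrix `M(i)`. -/
noncomputable def M (ω : Env) (i : ℤ) : Matrix (Fin 2) (Fin 2) ℝ :=
  !![(p₁ ω i + p₂ ω i) / q ω i, p₂ ω i / q ω i; 1, 0]

/-- The product `M(i - n) ⋯ M(i - 1) M(i)`, with the index increasing from left to right. -/
noncomputable def prodM (ω : Env) (i : ℤ) : ℕ → Matrix (Fin 2) (Fin 2) ℝ
  | 0 => M ω i
  | n + 1 => M ω (i - (n + 1 : ℕ)) * prodM ω i n

/-- The sum `M(i) + M(i - 1) M(i) + ⋯ + M(i - n) ⋯ M(i - 1) M(i)`. -/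
noncomputable def sumM (ω : Env) (i : ℤ) (n : ℕ) : Matrix (Fin 2) (Fin 2) ℝ :=
  ∑ m ∈ Finset.range (n + 1), prodM ω i m

/-- The quantity `γ(i)`. -/
noncomputable def gam (ω : Env) (i : ℤ) : ℝ :=
  q ω i * exitProb ω (i - 1) (i - 1) (i + 1)

/-- The quantity `α(i)`. -/
noncomputable def alp (ω : Env) (i : ℤ) : ℝ :=
  q ω i * exitProb ω (i - 1) (i - 1) i * (p₁ ω (i - 1) / (p₁ ω (i - 1) + gam ω (i - 1)))

/-- The quantity `β(i)`. -/
noncomputable def bet (ω : Env) (i : ℤ) : ℝ :=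
  q ω i * exitProb ω (i - 1) (i - 1) i * (gam ω (i - 1) / (p₁ ω (i - 1) + gam ω (i - 1)))

/-! ### The counting process -/

/-- The first ladder time `T₁ = inf {n > 0 : X_n > X_0}`; it is `⊤` if there is no such `n`. -/
noncomputable def T₁ (x : WalkPath) : ℕ∞ :=
  ⨅ (n : ℕ) (_ : 0 < n ∧ x 0 < x n), (n : ℕ∞)

/-- The times `n` of the steps from `i` to `i - 1` before `T₁` for which the next crossing back
to `[i, ∞)` takes place not later than `T₁` and is a jump from `s` to `t`. -/
def downSteps (x : WalkPath) (i s t : ℤ) : Set ℕ :=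
  {n | x n = i ∧ x (n + 1) = i - 1 ∧
    ∃ m, n < m ∧ ((m + 1 : ℕ) : ℕ∞) ≤ T₁ x ∧ (∀ k, n < k → k ≤ m → x k < i) ∧
      x m = s ∧ i ≤ x (m + 1) ∧ x (m + 1) = t}

/-- The step that ends at time `T₁` is a jump from `s` to `t`. -/
def LadderStep (x : WalkPath) (s t : ℤ) : Prop :=
  ∃ n : ℕ, ((n + 1 : ℕ) : ℕ∞) = T₁ x ∧ x n = s ∧ x (n + 1) = t

/-- Where a crossing back of type `0`, `1`, `2` (that is, `A`, `B`, `C`) of level `i` starts,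
relative to `i`. -/
def backFrom : Fin 3 → ℤ := ![-1, -2, -1]

/-- Where a crossing back of type `0`, `1`, `2` (that is, `A`, `B`, `C`) of level `i` ends,
relative to `i`. -/
def backTo : Fin 3 → ℤ := ![0, 0, 1]

open Classical in
/-- `U(i) = [A(i), B(i), C(i)]` for `i ≤ 0`, and the immigrant `U(1)`: there the walk is regarded as
having stepped from `1` to `0` before time `0`, and this one step is sorted by the crossing back at
time `T₁`, which is a jump `0 → 1`, `-1 → 1` or `0 → 2`. Only `i ≤ 1` is meaningful. -/
noncomputable def U (i : ℤ) (x : WalkPath) : Fin 3 → ℕ := fun t =>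
  if i ≤ 0 then (downSteps x i (i + backFrom t) (i + backTo t)).ncard
  else if LadderStep x (1 + backFrom t) (1 + backTo t) then 1 else 0

/-! ### Multitype branching processes -/

/-- The law of the next generation, if the present one has `u t` individuals of each type `t`: the
law of the sum of independent vectors, one for each individual, those of the individuals of
type `t` having law `off t`. -/
noncomputable def nextGeneration {ι : Type*} [Fintype ι] (off : ι → Measure (ι → ℕ)) (u : ι → ℕ) :
    Measure (ι → ℕ) :=
  (Measure.pi fun j : (t : ι) × Fin (u t) => off j.1).map fun ξ => ∑ j, ξ j

/-- `Z` is, under `μ`, an inhomogeneous multitype branching process: its generation `0` consists of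
immigrants with law `imm`, and given the generations `0, …, n` the individuals of generation `n`
reproduce independently, those of type `t` with offspring law `off n t`. -/
structure IsBranchingProcess {S ι : Type*} [MeasurableSpace S] [Fintype ι] (μ : Measure S)
    (Z : ℕ → S → ι → ℕ) (imm : Measure (ι → ℕ)) (off : ℕ → ι → Measure (ι → ℕ)) : Prop where
  measurable : ∀ n, Measurable (Z n)
  isProbabilityMeasure_imm : IsProbabilityMeasure imm
  isProbabilityMeasure_off : ∀ n t, IsProbabilityMeasure (off n t)
  map_zero : μ.map (Z 0) = imm
  measure_succ : ∀ (n : ℕ) (u : ℕ → ι → ℕ),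
    μ {s | ∀ k ≤ n + 1, Z k s = u k}
      = μ {s | ∀ k ≤ n, Z k s = u k} * nextGeneration (off n) (u n) {u (n + 1)}

/-- The law of the immigrant. -/
noncomputable def immigrationLaw (ω : Env) : Measure (Fin 3 → ℕ) :=
  ENNReal.ofReal (p₁ ω 0 / (1 - alp ω 0 - bet ω 0)) • Measure.dirac ![1, 0, 0]
    + ENNReal.ofReal (gam ω 0 / (1 - alp ω 0 - bet ω 0)) • Measure.dirac ![0, 1, 0]
    + ENNReal.ofReal (p₂ ω 0 / (1 - alp ω 0 - bet ω 0)) • Measure.dirac ![0, 0, 1]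

/-- The law of the children at level `i` of one individual of type `t` at level `i + 1`: mass
`(1 - α(i) - β(i)) (a + b choose a) α(i)^a β(i)^b` at `[a, b, 0]` for the types `A`, `C`, and at
`[a, b, 1]` for the type `B`. -/
noncomputable def offspringLaw (ω : Env) (i : ℤ) (t : Fin 3) : Measure (Fin 3 → ℕ) :=
  Measure.sum fun c : ℕ × ℕ =>
    ENNReal.ofReal ((1 - alp ω i - bet ω i) * ((c.1 + c.2).choose c.1 : ℝ)
        * alp ω i ^ c.1 * bet ω i ^ c.2)
      • Measure.dirac ![c.1, c.2, if t = 1 then 1 else 0]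

end RWRE

open RWRE

/-! Part (a) and the exit formulas of (b) rest on one recursion for generating functions. Number the
types A, B, C as 0, 1, 2. For complex weights `z j t` of modulus at most 1, equal to 1 below a level
`l`, let G_i(t) (`genFun`) be the expectation, starting at `i`, of the product of the weights of all
counted steps down from levels `l ≤ j ≤ i`, on the event that the first passage above `i` has type
`t`. Decompose at the first step. A step up is itself the passage, of type 0 or 2. A step down opens
an excursion below `i`; one that ends by a crossing of type s contributes z_i(s) G_{i-1}(s). If s is
0 or 1, the walk is back at `i` and starts afresh (`strong_markov`). If s is 2, the excursion ends
with the jump from `i - 1` to `i + 1`, which is a passage of type 1 above `i`. With r_i = q (z_i(0)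
G_{i-1}(0) + z_i(1) G_{i-1}(1)) this gives `genFun_mul`: G_i(t) (1 - r_i) equals p₁, q z_i(2)
G_{i-1}(2), p₂ for t = 0, 1, 2. Since |r_i| ≤ q < 1, the function G_i is determined by the products
z_i(t) G_{i-1}(t) (`genFun_congr`).

The theorem comes from three choices of weights.

All weights 1: G_i(t) is the probability of a passage of type `t`. Types 0 and 1 occur in the ratio
p₁ : γ, so the defining formulas of α and β reduce to q(i) times the probabilities of types 0 and 1
from `i - 1` (`alp_bet_eq`).

Arbitrary weights from level `l` up: at the lowest level, G_l(t) is the passage probability times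
the generating function of the offspring law (`genFun_bottom`). By `genFun_congr`, level `l` can
therefore be summed out by multiplying the weights of level `l + 1` by that generating function
(`mul_genFun_absorb`). This is the branching property in terms of transforms. Since the transforms
determine the laws (`ext_of_integral_monom_mul`), it yields the joint law of the generations
(`map_generations`).

Weight 0 at level `a`, and 1 elsewhere: only paths that stay in [a, ∞) survive, and `genFun_mul`
becomes a recursion for the exit probabilities (`exitProbBefore_rec`). The matrix sums satisfy a
matching recursion (`sumM_succ`), which proves the formulas of (b).

Transience makes the walk unbounded above from every starting point, so each first passage happens
almost surely and the passage probabilities add up to 1. Stationarity carries positivity of the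
three weights from site 0 to all sites. -/

namespace RWRE

/-! ### Measures on paths and the Markov property -/

/-- A finite measure on paths is determined by the masses of the cylinders. -/
theorem path_measure_ext {μ ν : Measure WalkPath} [IsFiniteMeasure μ] [IsFiniteMeasure ν]
    (h : ∀ (n : ℕ) (y : WalkPath), μ {x | ∀ m ≤ n, x m = y m} = ν {x | ∀ m ≤ n, x m = y m}) :
    μ = ν := by
  have hmap (n : ℕ) : μ.map (Preorder.frestrictLe (π := fun _ => ℤ) n)
      = ν.map (Preorder.frestrictLe (π := fun _ => ℤ) n) := by
    refine Measure.ext_of_singleton fun z => ?_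
    have hz : (Preorder.frestrictLe (π := fun _ => ℤ) n) ⁻¹' {z}
        = {x : WalkPath | ∀ m ≤ n, x m = (if hm : m ∈ Finset.Iic n then z ⟨m, hm⟩ else 0)} := by
      ext x
      simp only [Set.mem_preimage, Set.mem_singleton_iff, funext_iff, Preorder.frestrictLe_apply,
        Subtype.forall, Set.mem_ofPred_eq]
      refine forall_congr' fun m => ?_
      simp only [Finset.mem_Iic]
      refine forall_congr' fun hm => ?_
      simp [hm]
    rw [Measure.map_apply (by fun_prop) (measurableSet_singleton _),
      Measure.map_apply (by fun_prop) (measurableSet_singleton _), hz, h]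
  have hcyl (s : Set WalkPath) (hs : s ∈ measurableCylinders (fun _ : ℕ => ℤ)) : μ s = ν s := by
    rw [measurableCylinders_nat] at hs
    simp only [Set.mem_iUnion, Set.mem_singleton_iff] at hs
    obtain ⟨n, S, hS, rfl⟩ := hs
    have := congrArg (fun ρ => ρ S) (hmap n)
    simp only at this
    rwa [Measure.map_apply (by fun_prop) hS, Measure.map_apply (by fun_prop) hS] at this
  refine ext_of_generate_finite _ (generateFrom_measurableCylinders (α := fun _ : ℕ => ℤ)).symm
    isPiSystem_measurableCylinders hcyl ?_
  exact hcyl _ (univ_mem_measurableCylinders _)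

/-- The path after time `n`. -/
def after (n : ℕ) (x : WalkPath) : WalkPath := fun m => x (n + m)

@[simp] theorem after_apply (n : ℕ) (x : WalkPath) (m : ℕ) : after n x m = x (n + m) := rfl

@[fun_prop] theorem measurable_after (n : ℕ) : Measurable (after n) :=
  measurable_pi_lambda _ fun m => measurable_pi_apply (n + m)

theorem measurableSet_cylinder_le (n : ℕ) (y : WalkPath) :
    MeasurableSet {x : WalkPath | ∀ m ≤ n, x m = y m} := by
  have : {x : WalkPath | ∀ m ≤ n, x m = y m} = ⋂ m, ⋂ (_ : m ≤ n), {x : WalkPath | x m = y m} := by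
    ext x; simp
  rw [this]
  exact MeasurableSet.iInter fun m => MeasurableSet.iInter fun _ =>
    measurable_pi_apply m (measurableSet_singleton _)

/-- The chain starts at its starting point. -/
theorem quenched_zero (ω : Env) (k : ℤ) : ∀ᵐ x ∂quenched ω k, x 0 = k := by
  have h := quenched_cylinder_zero ω k (fun _ => k)
  have h0 : {x : WalkPath | ∀ m ≤ 0, x m = k} = {x | x 0 = k} := by
    ext x; simp
  rw [h0, Measure.dirac_apply_of_mem (by simp)] at h
  rw [ae_iff_prob_eq_one (by measurability)]
  exact h

/-- The mass of a cylinder is a product over its steps, and the product splits at time `n`. Starting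
the second factor at `g n` makes its constraint at time 0 automatic. -/
theorem quenched_cylinder_add (ω : Env) (k : ℤ) (n N : ℕ) (g : WalkPath) :
    quenched ω k {x | ∀ m ≤ n + N, x m = g m}
      = quenched ω k {x | ∀ m ≤ n, x m = g m}
        * quenched ω (g n) {x | ∀ m ≤ N, x m = after n g m} := by
  induction N with
  | zero =>
    rw [quenched_cylinder_zero]
    simp
  | succ N ih =>
    rw [quenched_cylinder_succ, ← add_assoc, quenched_cylinder_succ, ih, mul_assoc]
    rfl

/-- The Markov property, on a cylinder. -/
theorem markov_cylinder (ω : Env) (k : ℤ) (n : ℕ) (y : WalkPath) :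
    ((quenched ω k).restrict {x | ∀ m ≤ n, x m = y m}).map (after n)
      = quenched ω k {x | ∀ m ≤ n, x m = y m} • quenched ω (y n) := by
  have : IsFiniteMeasure (quenched ω k {x | ∀ m ≤ n, x m = y m} • quenched ω (y n)) :=
    Measure.smul_finite _ (measure_ne_top _ _)
  refine path_measure_ext fun N v => ?_
  rw [Measure.map_apply (measurable_after n) (measurableSet_cylinder_le _ _),
    Measure.restrict_apply ((measurable_after n) (measurableSet_cylinder_le _ _)),
    Measure.smul_apply, smul_eq_mul]
  -- If `v` starts where `y` ends, the two glue to one path `g`. Otherwise both sides vanish.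
  by_cases hv : v 0 = y n
  · set g : WalkPath := fun m => if m ≤ n then y m else v (m - n) with hg
    have hg1 (m : ℕ) (hm : m ≤ n) : g m = y m := by simp [hg, hm]
    have hg2 (m : ℕ) : g (n + m) = v m := by
      rcases m.eq_zero_or_pos with rfl | h
      · simp [hg, hv]
      · simp [hg, h.ne']
    have e1 : after n ⁻¹' {x | ∀ m ≤ N, x m = v m} ∩ {x | ∀ m ≤ n, x m = y m}
        = {x | ∀ m ≤ n + N, x m = g m} := by
      ext x
      simp only [Set.mem_inter_iff, Set.mem_preimage, Set.mem_ofPred_eq, after_apply]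
      constructor
      · rintro ⟨h1, h2⟩ m hm
        by_cases hmn : m ≤ n
        · rw [hg1 m hmn, h2 m hmn]
        · obtain ⟨l, rfl⟩ := Nat.exists_eq_add_of_le (le_of_not_ge hmn)
          rw [hg2, h1 l (by omega)]
      · intro h
        exact ⟨fun m hm => by rw [h _ (by omega), hg2], fun m hm => by
          rw [h _ (by omega), hg1 m hm]⟩
    have e2 : {x : WalkPath | ∀ m ≤ n, x m = y m} = {x | ∀ m ≤ n, x m = g m} := by
      ext x
      exact forall₂_congr fun m hm => by rw [hg1 m hm]
    have e3 : {x : WalkPath | ∀ m ≤ N, x m = v m} = {x | ∀ m ≤ N, x m = after n g m} := by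
      ext x
      simp [hg2]
    rw [e1, e2, e3, ← hg1 n le_rfl]
    exact quenched_cylinder_add ω k n N g
  · have e1 : after n ⁻¹' {x | ∀ m ≤ N, x m = v m} ∩ {x | ∀ m ≤ n, x m = y m} = ∅ := by
      ext x
      simp only [Set.mem_inter_iff, Set.mem_preimage, Set.mem_ofPred_eq, after_apply,
        Set.mem_empty_iff_false, iff_false, not_and]
      intro h1 h2
      exact hv (by rw [← h1 0 (Nat.zero_le _), ← h2 n le_rfl]; rfl)
    have e2 : quenched ω (y n) {x | ∀ m ≤ N, x m = v m} = 0 := by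
      refine measure_mono_null (t := {x | ¬ x 0 = y n}) ?_ (quenched_zero ω (y n))
      intro x hx
      simp only [Set.mem_ofPred_eq] at hx ⊢
      rw [hx 0 (Nat.zero_le _)]
      exact hv
    rw [e1, e2]; simp

/-- The Markov property at time `n`: on `x n = c`, past and future are independent. -/
theorem markov_prod (ω : Env) (k c : ℤ) (n : ℕ) :
    ((quenched ω k).restrict {x | x n = c}).map
        (fun x => (Preorder.frestrictLe (π := fun _ => ℤ) n x, after n x))
      = (((quenched ω k).restrict {x | x n = c}).map
          (Preorder.frestrictLe (π := fun _ => ℤ) n)).prod (quenched ω c) := by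
  symm
  refine Measure.prod_eq fun s t hs ht => ?_
  -- With the future event fixed, both sides are measures on the countable set of pasts, so single
  -- pasts suffice, and these are cylinders.
  have key : ((((quenched ω k).restrict {x | x n = c}).restrict (after n ⁻¹' t)).map
        (Preorder.frestrictLe (π := fun _ => ℤ) n))
      = quenched ω c t • (((quenched ω k).restrict {x | x n = c}).map
          (Preorder.frestrictLe (π := fun _ => ℤ) n)) := by
    refine Measure.ext_of_singleton fun z => ?_
    set y : WalkPath := fun m => if hm : m ∈ Finset.Iic n then z ⟨m, hm⟩ else 0 with hy
    have hz : (Preorder.frestrictLe (π := fun _ => ℤ) n) ⁻¹' {z}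
        = {x : WalkPath | ∀ m ≤ n, x m = y m} := by
      ext x
      simp only [Set.mem_preimage, Set.mem_singleton_iff, funext_iff, Preorder.frestrictLe_apply,
        Subtype.forall, Set.mem_ofPred_eq]
      refine forall_congr' fun m => ?_
      simp only [Finset.mem_Iic]
      refine forall_congr' fun hm => ?_
      simp [hm, hy]
    rw [Measure.smul_apply, Measure.map_apply (by fun_prop) (measurableSet_singleton _),
      Measure.map_apply (by fun_prop) (measurableSet_singleton _), hz,
      Measure.restrict_apply (measurableSet_cylinder_le _ _),
      Measure.restrict_apply (measurableSet_cylinder_le _ _),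
      Measure.restrict_apply ((measurableSet_cylinder_le _ _).inter (measurable_after n ht)),
      smul_eq_mul]
    by_cases hyc : y n = c
    · have h1 := congrArg (fun ρ => ρ t) (markov_cylinder ω k n y)
      simp only [Measure.map_apply (measurable_after n) ht, Measure.smul_apply, smul_eq_mul,
        Measure.restrict_apply (measurable_after n ht)] at h1
      have e1 : {x : WalkPath | ∀ m ≤ n, x m = y m} ∩ {x | x n = c}
          = {x : WalkPath | ∀ m ≤ n, x m = y m} := by
        ext x
        simp only [Set.mem_inter_iff, Set.mem_ofPred_eq, and_iff_left_iff_imp]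
        intro h
        rw [h n le_rfl, hyc]
      rw [Set.inter_right_comm, e1, Set.inter_comm, h1, hyc, mul_comm]
    · have e1 : {x : WalkPath | ∀ m ≤ n, x m = y m} ∩ {x | x n = c} = ∅ := by
        ext x
        simp only [Set.mem_inter_iff, Set.mem_ofPred_eq, Set.mem_empty_iff_false, iff_false, not_and]
        intro h h'
        exact hyc (by rw [← h n le_rfl, h'])
      rw [Set.inter_right_comm, e1]
      simp
  have h2 := congrArg (fun ρ => ρ s) key
  simp only [Measure.map_apply (Preorder.measurable_frestrictLe (X := fun _ => ℤ) n) hs, Measure.smul_apply, smul_eq_mul] at h2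
  rw [Measure.map_apply (by fun_prop) (hs.prod ht), Measure.map_apply (by fun_prop) hs, mul_comm,
    ← h2, Measure.restrict_apply (s := after n ⁻¹' t)
      (by exact (Preorder.measurable_frestrictLe (X := fun _ => ℤ) n) hs)]
  rfl

/-- A function that depends on the path up to time `n` only. -/
def DependsUpTo {β : Type*} (n : ℕ) (g : WalkPath → β) : Prop :=
  ∀ x x' : WalkPath, (∀ m ≤ n, x m = x' m) → g x = g x'

/-- The Markov property at time `n`, for integrals. -/
theorem integral_markov (ω : Env) (k c : ℤ) (n : ℕ) {g Ψ : WalkPath → ℂ} (hg : DependsUpTo n g)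
    (hΨ : Measurable Ψ) :
    ∫ x in {x | x n = c}, g x * Ψ (after n x) ∂quenched ω k
      = (∫ x in {x | x n = c}, g x ∂quenched ω k) * ∫ x, Ψ x ∂quenched ω c := by
  set g' : ((i : Finset.Iic n) → ℤ) → ℂ :=
    fun z => g fun m => if hm : m ∈ Finset.Iic n then z ⟨m, hm⟩ else 0 with hg'
  have hgg (x : WalkPath) : g x = g' (Preorder.frestrictLe (π := fun _ => ℤ) n x) := by
    refine hg _ _ fun m hm => ?_
    simp [hm]
  have hg'm : Measurable g' := measurable_of_countable _
  have h := integral_prod_mul (μ := ((quenched ω k).restrict {x | x n = c}).map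
          (Preorder.frestrictLe (π := fun _ => ℤ) n)) (ν := quenched ω c) g' Ψ
  rw [← markov_prod, integral_map (by fun_prop)
    (by exact ((hg'm.comp measurable_fst).mul (hΨ.comp measurable_snd)).aestronglyMeasurable),
    integral_map (by fun_prop) hg'm.aestronglyMeasurable] at h
  simp only [hgg]
  exact h

/-- The law of the next step, given the path up to time `n`. -/
theorem quenched_step (ω : Env) (k : ℤ) (n : ℕ) (y : WalkPath) (s : Set ℤ) :
    quenched ω k {x | (∀ m ≤ n, x m = y m) ∧ x (n + 1) ∈ s}
      = quenched ω k {x | ∀ m ≤ n, x m = y m} * stepLaw ω (y n) s := by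
  have key : (((quenched ω k).restrict {x | ∀ m ≤ n, x m = y m}).map fun x => x (n + 1))
      = quenched ω k {x | ∀ m ≤ n, x m = y m} • stepLaw ω (y n) := by
    refine Measure.ext_of_singleton fun c => ?_
    have hc : MeasurableSet {x : WalkPath | x (n + 1) = c} := by measurability
    set g : WalkPath := fun m => if m ≤ n then y m else c with hg
    have h := quenched_cylinder_succ ω k n g
    have e1 : {x : WalkPath | ∀ m ≤ n, x m = g m} = {x | ∀ m ≤ n, x m = y m} := by
      ext x
      exact forall₂_congr fun m hm => by simp [hg, hm]
    have e2 : {x : WalkPath | ∀ m ≤ n + 1, x m = g m}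
        = {x | x (n + 1) = c} ∩ {x | ∀ m ≤ n, x m = y m} := by
      ext x
      simp only [Set.mem_ofPred_eq, Set.mem_inter_iff]
      constructor
      · intro h
        refine ⟨by simpa [hg] using h (n + 1) le_rfl, fun m hm => ?_⟩
        simpa [hg, hm] using h m (by omega)
      · rintro ⟨h1, h2⟩ m hm
        rcases Nat.le_succ_iff.1 hm with hm | rfl
        · simpa [hg, hm] using h2 m hm
        · simpa [hg] using h1
    rw [Measure.map_apply (measurable_pi_apply _) (measurableSet_singleton _),
      Measure.restrict_apply (by exact hc), Measure.smul_apply, smul_eq_mul]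
    rw [e1, e2] at h
    simpa [hg] using! h
  have h := congrArg (fun ρ => ρ s) key
  simp only [Measure.smul_apply, smul_eq_mul] at h
  have hs : MeasurableSet {x : WalkPath | x (n + 1) ∈ s} := by
    have := measurable_pi_apply (X := fun _ : ℕ => ℤ) (n + 1)
    exact this .of_discrete
  rw [Measure.map_apply (by fun_prop) .of_discrete,
    Measure.restrict_apply (by exact hs)] at h
  rw [← h]
  congr 1
  ext x
  simp [and_comm]

/-- A path all of whose steps are `-1`, `1` or `2`. -/
def Legal (x : WalkPath) : Prop :=
  ∀ n, x (n + 1) = x n - 1 ∨ x (n + 1) = x n + 1 ∨ x (n + 1) = x n + 2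

theorem Legal.after {x : WalkPath} (hx : Legal x) (n : ℕ) : Legal (after n x) := fun m => hx (n + m)

/-- There are countably many pasts up to time `n`, and after each of them the step law gives no mass
to an illegal jump. -/
theorem ae_legal (ω : Env) (k : ℤ) : ∀ᵐ x ∂quenched ω k, Legal x := by
  rw [show (∀ᵐ x ∂quenched ω k, Legal x) ↔ _ from ae_all_iff]
  intro n
  have hcover : {x : WalkPath | ¬ (x (n + 1) = x n - 1 ∨ x (n + 1) = x n + 1 ∨ x (n + 1) = x n + 2)}
      ⊆ ⋃ z : Finset.Iic n → ℤ, {x : WalkPath |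
        (∀ m ≤ n, x m = (if hm : m ∈ Finset.Iic n then z ⟨m, hm⟩ else 0)) ∧
          x (n + 1) ∈ {c : ℤ | ¬ (c = z ⟨n, Finset.mem_Iic.2 le_rfl⟩ - 1 ∨
            c = z ⟨n, Finset.mem_Iic.2 le_rfl⟩ + 1 ∨ c = z ⟨n, Finset.mem_Iic.2 le_rfl⟩ + 2)}} := by
    intro x hx
    refine Set.mem_iUnion.2 ⟨Preorder.frestrictLe (π := fun _ => ℤ) n x, ?_⟩
    refine ⟨fun m hm => by simp [hm], ?_⟩
    simpa using hx
  refine measure_mono_null hcover (measure_iUnion_null fun z => ?_)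
  rw [quenched_step]
  simp [stepLaw]

/-! ### First passage above the starting point -/

/-- The path exceeds its starting point for the first time at time `n`. -/
def FirstPass (x : WalkPath) (n : ℕ) : Prop := x 0 < x n ∧ ∀ m < n, x m ≤ x 0

theorem FirstPass.pos {x : WalkPath} {n : ℕ} (h : FirstPass x n) : 0 < n := by
  rcases n.eq_zero_or_pos with rfl | h'
  · exact absurd h.1 (lt_irrefl _)
  · exact h'

theorem FirstPass.unique {x : WalkPath} {n m : ℕ} (h : FirstPass x n) (h' : FirstPass x m) :
    n = m := by
  rcases lt_trichotomy n m with hl | he | hl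
  · exact absurd (h'.2 n hl) (not_le.2 h.1)
  · exact he
  · exact absurd (h.2 m hl) (not_le.2 h'.1)

theorem exists_firstPass {x : WalkPath} {n : ℕ} (h : x 0 < x n) : ∃ m, FirstPass x m := by
  classical
  exact ⟨Nat.find ⟨n, h⟩, Nat.find_spec (⟨n, h⟩ : ∃ n, x 0 < x n),
    fun m hm => not_lt.1 (Nat.find_min (⟨n, h⟩ : ∃ n, x 0 < x n) hm)⟩

theorem le_T₁_iff {x : WalkPath} {m : ℕ} : (m : ℕ∞) ≤ T₁ x ↔ ∀ k < m, x k ≤ x 0 := by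
  simp only [T₁, le_iInf_iff, Nat.cast_le]
  constructor
  · intro h k hk
    by_contra hlt
    rw [not_le] at hlt
    have hk0 : 0 < k := by
      rcases k.eq_zero_or_pos with rfl | h'
      · exact absurd hlt (lt_irrefl _)
      · exact h'
    exact absurd (h k ⟨hk0, hlt⟩) (not_le.2 hk)
  · intro h k hk
    by_contra hlt
    exact absurd (h k (not_le.1 hlt)) (not_le.2 hk.2)

theorem T₁_eq_iff {x : WalkPath} {n : ℕ} : T₁ x = n ↔ FirstPass x n := by
  constructor
  · intro h
    have h1 := le_T₁_iff.1 h.ge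
    refine ⟨?_, h1⟩
    by_contra hlt
    have : ((n + 1 : ℕ) : ℕ∞) ≤ T₁ x := le_T₁_iff.2 fun k hk => by
      rcases Nat.lt_succ_iff_lt_or_eq.1 hk with hk | rfl
      · exact h1 k hk
      · exact not_lt.1 hlt
    rw [h, Nat.cast_le] at this
    omega
  · intro h
    refine le_antisymm ?_ (le_T₁_iff.2 h.2)
    exact iInf₂_le n ⟨h.pos, h.1⟩

theorem T₁_lt_top_iff {x : WalkPath} : T₁ x < ⊤ ↔ ∃ n, FirstPass x n := by
  rw [lt_top_iff_ne_top, ENat.ne_top_iff_exists]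
  exact exists_congr fun n => by rw [eq_comm, T₁_eq_iff]

theorem ladderStep_iff {x : WalkPath} {s t : ℤ} :
    LadderStep x s t ↔ ∃ n, FirstPass x (n + 1) ∧ x n = s ∧ x (n + 1) = t :=
  exists_congr fun n => by rw [eq_comm, T₁_eq_iff]

/-- The paths for which the first passage above level `i` has type `t`. -/
def passType (i : ℤ) (t : Fin 3) : Set WalkPath :=
  {x | LadderStep x (i + 1 + backFrom t) (i + 1 + backTo t)}

theorem mem_passType {i : ℤ} {t : Fin 3} {x : WalkPath} : x ∈ passType i t ↔
    ∃ n, FirstPass x (n + 1) ∧ x n = i + 1 + backFrom t ∧ x (n + 1) = i + 1 + backTo t :=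
  ladderStep_iff

theorem passType_disjoint {i : ℤ} {x : WalkPath} {s t : Fin 3} (hs : x ∈ passType i s)
    (ht : x ∈ passType i t) : s = t := by
  obtain ⟨n, h1, h2, h3⟩ := mem_passType.1 hs
  obtain ⟨m, h1', h2', h3'⟩ := mem_passType.1 ht
  obtain rfl : n = m := by simpa using h1.unique h1'
  rw [h2] at h2'
  rw [h3] at h3'
  revert h2' h3'
  fin_cases s <;> fin_cases t <;> simp [backFrom, backTo] <;> omega

/-- The last jump starts at or below `x 0` and ends above it, which leaves only 0 → 1, -1 → 1 and 0
→ 2 relative to `x 0`. Seen from level `x 0 + 1` these are the three types of crossing back, so one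
classification serves both passages and excursions. -/
theorem exists_passType {x : WalkPath} (hx : Legal x) {n : ℕ} (h : FirstPass x n) :
    ∃ t, x ∈ passType (x 0) t := by
  obtain ⟨m, rfl⟩ := Nat.exists_eq_succ_of_ne_zero h.pos.ne'
  have h1 := h.2 m (Nat.lt_succ_self m)
  have h2 := h.1
  simp only [mem_passType]
  rcases hx m with h3 | h3 | h3
  · simp only [Nat.succ_eq_add_one] at h2; omega
  · exact ⟨0, m, h, by simp [backFrom]; simp at h2; omega, by simp [backTo]; simp at h2; omega⟩
  · simp only [Nat.succ_eq_add_one] at h2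
    by_cases h4 : x m = x 0
    · exact ⟨2, m, h, by simp [backFrom]; omega, by simp [backTo]; omega⟩
    · exact ⟨1, m, h, by simp [backFrom]; omega, by simp [backTo]; omega⟩

/-! ### Counting the steps down -/

/-- The steps from `j` to `j - 1` before time `τ` for which the next crossing back takes place not
later than `τ` and is a jump from `s` to `t`. -/
def downs (x : WalkPath) (τ : ℕ) (j s t : ℤ) : Set ℕ :=
  {n | x n = j ∧ x (n + 1) = j - 1 ∧
    ∃ m, n < m ∧ m + 1 ≤ τ ∧ (∀ k, n < k → k ≤ m → x k < j) ∧ x m = s ∧ j ≤ x (m + 1) ∧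
      x (m + 1) = t}

theorem downSteps_eq {x : WalkPath} {τ : ℕ} (h : FirstPass x τ) (j s t : ℤ) :
    downSteps x j s t = downs x τ j s t := by
  ext n
  simp only [downSteps, downs, T₁_eq_iff.2 h, Nat.cast_le]

theorem downs_subset (x : WalkPath) (τ : ℕ) (j s t : ℤ) : downs x τ j s t ⊆ Set.Iio τ := by
  rintro n ⟨-, -, m, h1, h2, -⟩
  exact Set.mem_Iio.2 (by omega)

theorem downs_finite (x : WalkPath) (τ : ℕ) (j s t : ℤ) : (downs x τ j s t).Finite :=
  (Set.finite_Iio τ).subset (downs_subset x τ j s t)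

theorem downs_congr {x x' : WalkPath} {τ : ℕ} (h : ∀ m ≤ τ, x m = x' m) (j s t : ℤ) :
    downs x τ j s t = downs x' τ j s t := by
  have key : ∀ x x' : WalkPath, (∀ m ≤ τ, x m = x' m) → downs x τ j s t ⊆ downs x' τ j s t := by
    rintro x x' h n ⟨h1, h2, m, h3, h4, h5, h6, h7, h8⟩
    refine ⟨by rw [← h n (by omega), h1], by rw [← h _ (by omega), h2], m, h3, h4,
      fun k hk hkm => ?_, ?_, ?_, ?_⟩
    · rw [← h k (by omega)]; exact h5 k hk hkm
    · rw [← h _ (by omega), h6]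
    · rw [← h _ (by omega)]; exact h7
    · rw [← h _ (by omega), h8]
  exact (key x x' h).antisymm (key x' x fun m hm => (h m hm).symm)

/-- Since `j ≤ x σ`, no excursion below `j` is under way at time `σ`: every counted step and its
crossing back lie on the same side of `σ`. -/
theorem downs_cut {x : WalkPath} {σ ρ : ℕ} {j : ℤ} (hj : j ≤ x σ) (s t : ℤ) :
    downs x (σ + ρ) j s t
      = downs x σ j s t ∪ (fun n => σ + n) '' downs (after σ x) ρ j s t := by
  ext n
  constructor
  · rintro ⟨h1, h2, m, h3, h4, h5, h6, h7, h8⟩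
    by_cases hn : n < σ
    · refine Or.inl ⟨h1, h2, m, h3, ?_, h5, h6, h7, h8⟩
      by_contra hm
      exact absurd (h5 σ hn (by omega)) (not_lt.2 hj)
    · obtain ⟨l, rfl⟩ := Nat.exists_eq_add_of_le (not_lt.1 hn)
      obtain ⟨r, rfl⟩ := Nat.exists_eq_add_of_le (show σ ≤ m by omega)
      exact Or.inr ⟨l, ⟨h1, h2, r, by omega, by omega,
        fun k hk hkm => h5 _ (by omega) (by omega), h6, h7, h8⟩, rfl⟩
  · rintro (⟨h1, h2, m, h3, h4, h5⟩ | ⟨l, ⟨h1, h2, m, h3, h4, h5, h6, h7, h8⟩, rfl⟩)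
    · exact ⟨h1, h2, m, h3, by omega, h5⟩
    · refine ⟨h1, h2, σ + m, by simp only; omega, by omega, fun k hk hkm => ?_, h6, h7, h8⟩
      simp only at hk
      obtain ⟨r, rfl⟩ := Nat.exists_eq_add_of_le (show σ ≤ k by omega)
      exact h5 r (by omega) (by omega)

theorem ncard_downs_cut {x : WalkPath} {σ ρ : ℕ} {j : ℤ} (hj : j ≤ x σ) (s t : ℤ) :
    (downs x (σ + ρ) j s t).ncard
      = (downs x σ j s t).ncard + (downs (after σ x) ρ j s t).ncard := by
  rw [downs_cut hj, Set.ncard_union_eq ?_ (downs_finite _ _ _ _ _)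
    ((downs_finite _ _ _ _ _).image _), Set.ncard_image_of_injective _ (add_right_injective σ)]
  refine Set.disjoint_left.2 fun n hn => ?_
  rintro ⟨l, -, rfl⟩
  have := downs_subset _ _ _ _ _ hn
  simp at this

theorem downs_of_le_one {τ : ℕ} (hτ : τ ≤ 1) (x : WalkPath) (j s t : ℤ) : downs x τ j s t = ∅ := by
  refine Set.eq_empty_of_forall_notMem ?_
  rintro n ⟨-, -, m, h1, h2, -⟩
  omega

/-- Between the first step and the last the path stays strictly below `i`, so the only step down
from `i` is at time 0, and its crossing back is the last step. -/
theorem downs_excursion {x : WalkPath} {i : ℤ} {n : ℕ} (h0 : x 0 = i) (h1 : x 1 = i - 1)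
    (hy : FirstPass (after 1 x) (n + 1)) (s t : ℤ) :
    downs x (1 + (n + 1)) i s t
      = if after 1 x n = s ∧ after 1 x (n + 1) = t then {0} else ∅ := by
  have hlt (k : ℕ) (hk : 0 < k) (hkn : k ≤ n + 1) : x k < i := by
    have := hy.2 (k - 1) (by omega)
    simp only [after_apply, add_zero, h1] at this
    rw [show 1 + (k - 1) = k by omega] at this
    omega
  have hge : i ≤ x (n + 1 + 1) := by
    have := hy.1
    simp only [after_apply, add_zero, h1] at this
    rw [show n + 1 + 1 = 1 + (n + 1) by omega]
    omega
  have e1 : after 1 x n = x (n + 1) := by rw [after_apply, add_comm]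
  have e2 : after 1 x (n + 1) = x (n + 1 + 1) := by rw [after_apply, add_comm]
  rw [add_comm 1 (n + 1)]
  simp only [e1, e2]
  have hn : ∀ l ∈ downs x (n + 1 + 1) i s t, l = 0 := by
    rintro l ⟨h2, h3, m, h4, h5, h6⟩
    by_contra hl
    have := hlt l (by omega) (by omega)
    omega
  split_ifs with hst
  · ext l
    refine ⟨hn l, ?_⟩
    rintro rfl
    exact ⟨h0, h1, n + 1, by omega, by omega, fun k hk hkm => hlt k hk hkm, hst.1, hge, hst.2⟩
  · refine Set.eq_empty_of_forall_notMem fun l hl => ?_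
    obtain rfl := hn l hl
    obtain ⟨h2, h3, m, h4, h5, h6, h7, h8, h9⟩ := hl
    have hm : m = n + 1 := by
      by_contra hm
      have := hlt (m + 1) (by omega) (by omega)
      omega
    subst hm
    exact hst ⟨h7, h9⟩

/-- The number of steps down from `j` whose crossing back has type `t`. -/
noncomputable def cnt (x : WalkPath) (j : ℤ) (t : Fin 3) : ℕ :=
  (downSteps x j (j + backFrom t) (j + backTo t)).ncard

theorem cnt_eq {x : WalkPath} {τ : ℕ} (h : FirstPass x τ) (j : ℤ) (t : Fin 3) :
    cnt x j t = (downs x τ j (j + backFrom t) (j + backTo t)).ncard := by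
  rw [cnt, downSteps_eq h]

/-- The time `T₁` as a natural number. -/
noncomputable def passTime (x : WalkPath) : ℕ := (T₁ x).toNat

theorem FirstPass.passTime {x : WalkPath} {n : ℕ} (h : FirstPass x n) : passTime x = n := by
  rw [RWRE.passTime, T₁_eq_iff.2 h]; simp

/-- The counts of a path that steps down, comes back by a crossing of type `s`, and has its first
passage `ρ` steps after that. -/
theorem cnt_decomp {x : WalkPath} {i : ℤ} {n ρ : ℕ} {s : Fin 3} (h0 : x 0 = i) (h1 : x 1 = i - 1)
    (hy : FirstPass (after 1 x) (n + 1)) (hs : after 1 x n = i + backFrom s)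
    (ht : after 1 x (n + 1) = i + backTo s) (hτ : FirstPass x (1 + (n + 1) + ρ)) :
    (∀ j ≤ i - 1, ∀ t, cnt x j t = cnt (after 1 x) j t
      + (downs (after (n + 1) (after 1 x)) ρ j (j + backFrom t) (j + backTo t)).ncard) ∧
    ∀ t, cnt x i t = (if s = t then 1 else 0)
      + (downs (after (n + 1) (after 1 x)) ρ i (i + backFrom t) (i + backTo t)).ncard := by
  have haft : after (n + 1) (after 1 x) = after (1 + (n + 1)) x := by
    ext m; simp [add_assoc]
  have hge : i ≤ x (1 + (n + 1)) := by
    have := hy.1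
    simp only [after_apply, add_zero, h1] at this
    omega
  constructor
  · intro j hj t
    -- Two cuts: at the end of the excursion and after the first step, where `x 1 = i - 1` is still
    -- at or above `j`. The piece of length one has no room for a step down and a crossing back.
    rw [cnt_eq hτ, cnt_eq hy, ncard_downs_cut (by omega), ncard_downs_cut (σ := 1) (by omega),
      downs_of_le_one le_rfl, haft]
    simp
  · intro t
    rw [cnt_eq hτ, ncard_downs_cut hge, downs_excursion h0 h1 hy, haft]
    congr 1
    by_cases hst : s = t
    · subst hst
      rw [if_pos ⟨hs, ht⟩, if_pos rfl, Set.ncard_singleton]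
    · rw [if_neg, if_neg hst, Set.ncard_empty]
      rw [hs, ht]
      revert hst
      fin_cases s <;> fin_cases t <;> simp [backFrom, backTo] 

theorem firstPass_return {x : WalkPath} {i : ℤ} {σ : ℕ} (h0 : x 0 = i) (h1 : x 1 = i - 1)
    (hy : FirstPass (after 1 x) σ) (hi : after 1 x σ = i) (ρ : ℕ) :
    FirstPass x (1 + σ + ρ) ↔ FirstPass (after σ (after 1 x)) ρ := by
  have hle (k : ℕ) (hk : k < 1 + σ) : x k ≤ i := by
    rcases k.eq_zero_or_pos with rfl | hk0
    · omega
    · have := hy.2 (k - 1) (by omega)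
      simp only [after_apply, add_zero, h1] at this
      rw [show 1 + (k - 1) = k by omega] at this
      omega
  simp only [after_apply] at hi
  simp only [FirstPass, after_apply, add_zero, ← add_assoc, hi, h0]
  refine and_congr_right fun h => ⟨fun h m hm => h _ (by omega), fun h m hm => ?_⟩
  by_cases hm1 : m < 1 + σ
  · exact hle m hm1
  · obtain ⟨r, rfl⟩ := Nat.exists_eq_add_of_le (not_lt.1 hm1)
    exact h r (by omega)

theorem le_of_firstPass_return {x : WalkPath} {i : ℤ} {σ τ : ℕ} (h0 : x 0 = i) (h1 : x 1 = i - 1)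
    (hy : FirstPass (after 1 x) σ) (h : FirstPass x τ) : 1 + σ ≤ τ := by
  by_contra hlt
  have h2 := h.pos
  have h3 := hy.2 (τ - 1) (by omega)
  simp only [after_apply, add_zero, h1] at h3
  rw [show 1 + (τ - 1) = τ by omega] at h3
  have := h.1
  omega

/-- The first passage is a stopping time. This and the two congruence lemmas below verify the
hypothesis `hdep` of `strong_markov`. -/
theorem FirstPass.congr {x x' : WalkPath} {n : ℕ} (h : FirstPass x n) (hxx : ∀ m ≤ n, x m = x' m) :
    FirstPass x' n := by
  refine ⟨?_, fun m hm => ?_⟩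
  · rw [← hxx 0 (Nat.zero_le _), ← hxx n le_rfl]; exact h.1
  · rw [← hxx 0 (Nat.zero_le _), ← hxx m hm.le]; exact h.2 m hm

theorem cnt_congr {x x' : WalkPath} {n : ℕ} (h : FirstPass x n) (hxx : ∀ m ≤ n, x m = x' m)
    (j : ℤ) (t : Fin 3) : cnt x j t = cnt x' j t := by
  rw [cnt_eq h, cnt_eq (h.congr hxx), downs_congr hxx]

theorem passType_congr {x x' : WalkPath} {n : ℕ} (h : FirstPass x n) (hxx : ∀ m ≤ n, x m = x' m)
    {i : ℤ} {t : Fin 3} (hx : x ∈ passType i t) : x' ∈ passType i t := by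
  obtain ⟨m, h1, h2, h3⟩ := mem_passType.1 hx
  obtain rfl := h.unique h1
  exact mem_passType.2 ⟨m, h1.congr hxx, by rw [← hxx _ (by omega), h2],
    by rw [← hxx _ (by omega), h3]⟩

/-! ### Measurability -/

theorem measurableSet_firstPass (n : ℕ) : MeasurableSet {x | FirstPass x n} := by
  unfold FirstPass
  measurability

theorem measurableSet_passType (i : ℤ) (t : Fin 3) : MeasurableSet (passType i t) := by
  have : passType i t = ⋃ n, ({x | FirstPass x (n + 1)} ∩ {x | x n = i + 1 + backFrom t}
      ∩ {x | x (n + 1) = i + 1 + backTo t}) := by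
    ext x
    simp only [mem_passType, Set.mem_iUnion, Set.mem_inter_iff, Set.mem_ofPred_eq, and_assoc]
  rw [this]
  refine MeasurableSet.iUnion fun n => ((measurableSet_firstPass _).inter ?_).inter ?_ <;>
  measurability

theorem measurable_ncard_of {A : WalkPath → Set ℕ} (hA : ∀ n, MeasurableSet {x | n ∈ A x}) :
    Measurable fun x => (A x).ncard := by
  have h1 : Measurable fun x => ((A x).encard : ENNReal) := by
    have : ∀ x, ((A x).encard : ENNReal)
        = ∑' n : ℕ, {x | n ∈ A x}.indicator (1 : WalkPath → ENNReal) x := by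
      intro x
      rw [← ENNReal.tsum_set_one, tsum_subtype (A x) (fun _ => (1 : ENNReal))]
      rfl
    simp only [this]
    exact Measurable.tsum fun n => measurable_one.indicator (hA n)
  -- For infinite sets the conventions agree: `ncard` is 0, and so is the real part of `⊤`.
  have h2 : ∀ x, (A x).ncard = ⌊((A x).encard : ENNReal).toReal⌋₊ := by
    intro x
    by_cases hx : (A x).Finite
    · rw [← hx.cast_ncard_eq]
      simp
    · rw [Set.Infinite.ncard hx, Set.Infinite.encard_eq hx]
      simp
  simp only [h2]
  exact Nat.measurable_floor.comp h1.ennreal_toReal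

theorem measurableSet_downSteps (j s t : ℤ) (n : ℕ) : MeasurableSet {x | n ∈ downSteps x j s t} := by
  simp only [downSteps, le_T₁_iff, Set.mem_ofPred_eq]
  measurability

theorem measurable_cnt (j : ℤ) (t : Fin 3) : Measurable fun x => cnt x j t :=
  measurable_ncard_of (measurableSet_downSteps _ _ _)

theorem measurable_passTime : Measurable passTime := by
  refine measurable_to_countable' fun n => ?_
  -- Paths without a first passage have `passTime` 0 by default, which accounts for the second set.
  have : passTime ⁻¹' {n}
      = {x | FirstPass x n} ∪ ({x | ∃ m, FirstPass x m}ᶜ ∩ {_x : WalkPath | n = 0}) := by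
    ext x
    simp only [Set.mem_preimage, Set.mem_singleton_iff, Set.mem_union, Set.mem_inter_iff,
      Set.mem_compl_iff, Set.mem_ofPred_eq]
    by_cases h : ∃ m, FirstPass x m
    · obtain ⟨m, hm⟩ := h
      rw [hm.passTime]
      constructor
      · rintro rfl
        exact .inl hm
      · rintro (h | h)
        · exact hm.unique h
        · exact absurd ⟨m, hm⟩ h.1
    · have : T₁ x = ⊤ := by rwa [← not_lt_top_iff, T₁_lt_top_iff]
      rw [passTime, this]
      simp only [ENat.toNat_top, h, not_false_eq_true, true_and]
      exact ⟨fun h => .inr h.symm, fun h' => h'.elim (fun h1 => absurd ⟨n, h1⟩ h) Eq.symm⟩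
  rw [this]
  refine (measurableSet_firstPass n).union (MeasurableSet.inter ?_ (MeasurableSet.const _))
  rw [Set.ofPred_exists]
  exact (MeasurableSet.iUnion measurableSet_firstPass).compl

/-! ### The strong Markov property at the first passage -/

theorem measurable_after_passTime : Measurable fun x => after (passTime x) x := by
  have h : Measurable fun p : WalkPath × ℕ => after p.2 p.1 :=
    measurable_from_prod_countable_left fun n => measurable_after n
  exact h.comp (measurable_id.prodMk measurable_passTime)

theorem integrable_of_norm_le_one {S : Type*} [MeasurableSpace S] {μ : Measure S}
    [IsFiniteMeasure μ] {f : S → ℂ} (hf : Measurable f) (h : ∀ x, ‖f x‖ ≤ 1) : Integrable f μ :=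
  Integrable.of_bound hf.aestronglyMeasurable 1 (.of_forall h)

/-- The strong Markov property at the first passage above the starting point. -/
theorem strong_markov (ω : Env) (k c : ℤ) {E : Set WalkPath} {Φ Ψ : WalkPath → ℂ}
    (hE : MeasurableSet E) (hΦ : Measurable Φ) (hΦ1 : ∀ x, ‖Φ x‖ ≤ 1) (hΨ : Measurable Ψ)
    (hΨ1 : ∀ x, ‖Ψ x‖ ≤ 1) (hEc : ∀ x ∈ E, ∃ n, FirstPass x n ∧ x n = c)
    (hdep : ∀ x x' n, FirstPass x n → (∀ m ≤ n, x m = x' m) → (x ∈ E → x' ∈ E) ∧ Φ x = Φ x') :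
    ∫ x in E, Φ x * Ψ (after (passTime x) x) ∂quenched ω k
      = (∫ x in E, Φ x ∂quenched ω k) * ∫ x, Ψ x ∂quenched ω c := by
  -- Sorting by the value of the passage time reduces the claim to the Markov property at fixed
  -- times.
  set En : ℕ → Set WalkPath := fun n => E ∩ {x | FirstPass x n} with hEn
  have hEnm (n : ℕ) : MeasurableSet (En n) := hE.inter (measurableSet_firstPass n)
  have hU : E = ⋃ n, En n := by
    ext x
    simp only [hEn, Set.mem_iUnion, Set.mem_inter_iff, Set.mem_ofPred_eq, exists_and_left]
    exact ⟨fun h => ⟨h, (hEc x h).imp fun n hn => hn.1⟩, fun h => h.1⟩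
  have hdisj : Pairwise (Function.onFun Disjoint En) := by
    intro n m hnm
    refine Set.disjoint_left.2 fun x hx hx' => hnm (hx.2.unique hx'.2)
  have hΨm : Measurable fun x => Ψ (after (passTime x) x) := hΨ.comp measurable_after_passTime
  have hi1 : Integrable (fun x => Φ x * Ψ (after (passTime x) x)) (quenched ω k) :=
    integrable_of_norm_le_one (hΦ.mul hΨm) fun x => by
      rw [norm_mul]; exact mul_le_one₀ (hΦ1 x) (norm_nonneg _) (hΨ1 _)
  have hi2 : Integrable Φ (quenched ω k) := integrable_of_norm_le_one hΦ hΦ1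
  have h1 := hasSum_integral_iUnion hEnm hdisj (hi1.integrableOn (s := ⋃ n, En n))
  have h2 := (hasSum_integral_iUnion hEnm hdisj (hi2.integrableOn (s := ⋃ n, En n))).mul_right
    (∫ x, Ψ x ∂quenched ω c)
  rw [← hU] at h1 h2
  suffices h : ∀ n, ∫ x in En n, Φ x * Ψ (after (passTime x) x) ∂quenched ω k
      = (∫ x in En n, Φ x ∂quenched ω k) * ∫ x, Ψ x ∂quenched ω c by
    simp only [h] at h1
    exact h1.unique h2
  intro n
  have hsub : {x : WalkPath | x n = c} ∩ En n = En n := by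
    refine Set.inter_eq_right.2 fun x hx => ?_
    obtain ⟨m, hm, hmc⟩ := hEc x hx.1
    rw [hm.unique hx.2] at hmc
    exact hmc
  have hg : DependsUpTo n ((En n).indicator Φ) := by
    intro x x' hxx
    by_cases hx : x ∈ En n
    · have h3 := hdep x x' n hx.2 hxx
      rw [Set.indicator_of_mem hx, Set.indicator_of_mem (show x' ∈ En n from
        ⟨h3.1 hx.1, FirstPass.congr hx.2 hxx⟩), h3.2]
    · have hx' : x' ∉ En n := fun hx' => hx
        ⟨(hdep x' x n hx'.2 fun m hm => (hxx m hm).symm).1 hx'.1,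
          FirstPass.congr hx'.2 fun m hm => (hxx m hm).symm⟩
      rw [Set.indicator_of_notMem hx, Set.indicator_of_notMem hx']
  have h3 := integral_markov ω k c n hg hΨ
  rw [setIntegral_indicator (hEnm n), hsub] at h3
  rw [← h3]
  have h4 : ∀ x, (En n).indicator Φ x * Ψ (after n x)
      = (En n).indicator (fun x => Φ x * Ψ (after n x)) x := by
    intro x
    by_cases hx : x ∈ En n <;> simp [hx]
  simp only [h4]
  rw [setIntegral_indicator (hEnm n), hsub]
  refine setIntegral_congr_fun (hEnm n) fun x hx => ?_
  rw [FirstPass.passTime hx.2]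

/-! ### Generating functions of the excursions -/

/-- The product of the weights `z j t` of the steps down, over the levels `l ≤ j ≤ i`. -/
noncomputable def wt (l : ℤ) (z : ℤ → Fin 3 → ℂ) (i : ℤ) (x : WalkPath) : ℂ :=
  ∏ j ∈ Finset.Icc l i, ∏ t, z j t ^ cnt x j t

/-- The generating function of the counts of the levels `l ≤ j ≤ i`, up to the first passage above
`i`, for the walk that starts at `i` and has a first passage of type `t`. -/
noncomputable def genFun (ω : Env) (l : ℤ) (z : ℤ → Fin 3 → ℂ) (i : ℤ) (t : Fin 3) : ℂ :=
  ∫ x in passType i t, wt l z i x ∂quenched ω i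

theorem measurable_wt (l : ℤ) (z : ℤ → Fin 3 → ℂ) (i : ℤ) : Measurable (wt l z i) := by
  unfold wt
  refine Finset.measurable_prod _ fun j _ => Finset.measurable_prod _ fun t _ => ?_
  exact (measurable_of_countable fun n : ℕ => z j t ^ n).comp (measurable_cnt j t)

theorem norm_wt_le {z : ℤ → Fin 3 → ℂ} (hz : ∀ j t, ‖z j t‖ ≤ 1) (l i : ℤ) (x : WalkPath) :
    ‖wt l z i x‖ ≤ 1 := by
  unfold wt
  rw [norm_prod]
  refine Finset.prod_le_one (fun _ _ => norm_nonneg _) fun j _ => ?_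
  rw [norm_prod]
  refine Finset.prod_le_one (fun _ _ => norm_nonneg _) fun t _ => ?_
  rw [norm_pow]
  exact pow_le_one₀ (norm_nonneg _) (hz j t)

/-- The convention that `z` is 1 below `l` lets the top level be split off even for `i < l`, where
both products are empty. The recursion then needs no boundary case. -/
theorem wt_eq_mul {l : ℤ} {z : ℤ → Fin 3 → ℂ} (hl : ∀ j < l, ∀ t, z j t = 1) (i : ℤ)
    (x : WalkPath) : wt l z i x = (∏ t, z i t ^ cnt x i t) * wt l z (i - 1) x := by
  by_cases h : l ≤ i
  · have : Finset.Icc l i = insert i (Finset.Icc l (i - 1)) := by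
      ext j; simp only [Finset.mem_Icc, Finset.mem_insert]; omega
    rw [wt, this, Finset.prod_insert (by simp), wt]
  · rw [wt, wt, Finset.Icc_eq_empty (by omega), Finset.Icc_eq_empty (by omega)]
    simp [hl i (by omega)]

theorem wt_congr {x x' : WalkPath} {n : ℕ} (h : FirstPass x n) (hxx : ∀ m ≤ n, x m = x' m)
    (l : ℤ) (z : ℤ → Fin 3 → ℂ) (i : ℤ) : wt l z i x = wt l z i x' := by
  unfold wt
  simp only [cnt_congr h hxx]

theorem wt_return {l : ℤ} {z : ℤ → Fin 3 → ℂ} (hl : ∀ j < l, ∀ t, z j t = 1) {x : WalkPath} {i : ℤ}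
    {n ρ : ℕ} {s : Fin 3} (h0 : x 0 = i) (h1 : x 1 = i - 1)
    (hy : FirstPass (after 1 x) (n + 1)) (hs : after 1 x n = i + backFrom s)
    (ht : after 1 x (n + 1) = i + backTo s) (hτ : FirstPass x (1 + (n + 1) + ρ))
    (hw : FirstPass (after (n + 1) (after 1 x)) ρ) :
    wt l z i x = z i s * wt l z (i - 1) (after 1 x)
      * wt l z i (after (n + 1) (after 1 x)) := by
  obtain ⟨h2, h3⟩ := cnt_decomp h0 h1 hy hs ht hτ
  simp only [← cnt_eq hw] at h2 h3
  have h4 : wt l z (i - 1) x = wt l z (i - 1) (after 1 x)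
      * wt l z (i - 1) (after (n + 1) (after 1 x)) := by
    unfold wt
    rw [← Finset.prod_mul_distrib]
    refine Finset.prod_congr rfl fun j hj => ?_
    rw [← Finset.prod_mul_distrib]
    refine Finset.prod_congr rfl fun t _ => ?_
    rw [h2 j (Finset.mem_Icc.1 hj).2 t, pow_add]
  have h5 : ∏ t, z i t ^ cnt x i t
      = z i s * ∏ t, z i t ^ cnt (after (n + 1) (after 1 x)) i t := by
    simp only [h3, pow_add, Finset.prod_mul_distrib]
    congr 1
    simp [pow_ite]
  rw [wt_eq_mul hl, h4, h5, wt_eq_mul hl i (after (n + 1) (after 1 x))]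
  ring

/-- Here the end of the excursion is already the first passage above `i`, so nothing remains after
it: the case `ρ = 0` of `cnt_decomp`. -/
theorem wt_direct {l : ℤ} {z : ℤ → Fin 3 → ℂ} (hl : ∀ j < l, ∀ t, z j t = 1) {x : WalkPath} {i : ℤ}
    {n : ℕ} {s : Fin 3} (h0 : x 0 = i) (h1 : x 1 = i - 1)
    (hy : FirstPass (after 1 x) (n + 1)) (hs : after 1 x n = i + backFrom s)
    (ht : after 1 x (n + 1) = i + backTo s) (hτ : FirstPass x (1 + (n + 1))) :
    wt l z i x = z i s * wt l z (i - 1) (after 1 x) := by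
  obtain ⟨h2, h3⟩ := cnt_decomp (ρ := 0) h0 h1 hy hs ht hτ
  simp only [downs_of_le_one (Nat.zero_le 1), Set.ncard_empty, add_zero] at h2 h3
  rw [wt_eq_mul hl]
  congr 1
  · simp [h3, pow_ite]
  · unfold wt
    exact Finset.prod_congr rfl fun j hj => Finset.prod_congr rfl fun t _ => by
      rw [h2 j (Finset.mem_Icc.1 hj).2 t]

theorem wt_of_step_up {l : ℤ} (z : ℤ → Fin 3 → ℂ) {x : WalkPath} (i : ℤ) (h : FirstPass x 1) :
    wt l z i x = 1 := by
  simp [wt, cnt_eq h, downs_of_le_one le_rfl]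

/-- The weight of a first passage of type `t` above `i`. -/
noncomputable def passWt (l : ℤ) (z : ℤ → Fin 3 → ℂ) (i : ℤ) (t : Fin 3) : WalkPath → ℂ :=
  (passType i t).indicator (wt l z i)

theorem measurable_passWt (l : ℤ) (z : ℤ → Fin 3 → ℂ) (i : ℤ) (t : Fin 3) :
    Measurable (passWt l z i t) :=
  (measurable_wt l z i).indicator (measurableSet_passType i t)

theorem norm_passWt_le {z : ℤ → Fin 3 → ℂ} (hz : ∀ j t, ‖z j t‖ ≤ 1) (l i : ℤ) (t : Fin 3)
    (x : WalkPath) : ‖passWt l z i t x‖ ≤ 1 := by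
  unfold passWt
  by_cases h : x ∈ passType i t
  · rw [Set.indicator_of_mem h]; exact norm_wt_le hz l i x
  · rw [Set.indicator_of_notMem h]; simp

theorem integral_passWt (ω : Env) (l : ℤ) (z : ℤ → Fin 3 → ℂ) (i : ℤ) (t : Fin 3) :
    ∫ x, passWt l z i t x ∂quenched ω i = genFun ω l z i t :=
  integral_indicator (measurableSet_passType i t)

/-- The weight after a first step down, as a function of the path after this step. -/
noncomputable def downWt (l : ℤ) (z : ℤ → Fin 3 → ℂ) (i : ℤ) (t : Fin 3) (y : WalkPath) : ℂ :=
  (z i 0 * (passWt l z (i - 1) 0 y * passWt l z i t (after (passTime y) y))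
    + z i 1 * (passWt l z (i - 1) 1 y * passWt l z i t (after (passTime y) y)))
    + if t = 1 then z i 2 * passWt l z (i - 1) 2 y else 0

theorem passWt_of_mem (l : ℤ) (z : ℤ → Fin 3 → ℂ) {i : ℤ} {t : Fin 3} {x : WalkPath}
    (h : x ∈ passType i t) : passWt l z i t x = wt l z i x :=
  Set.indicator_of_mem h _

theorem passWt_of_notMem (l : ℤ) (z : ℤ → Fin 3 → ℂ) {i : ℤ} {t : Fin 3} {x : WalkPath}
    (h : x ∉ passType i t) : passWt l z i t x = 0 :=
  Set.indicator_of_notMem h _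

theorem passWt_of_mem_of_ne {l : ℤ} {z : ℤ → Fin 3 → ℂ} {i : ℤ} {s t : Fin 3} {x : WalkPath}
    (h : x ∈ passType i s) (hst : s ≠ t) : passWt l z i t x = 0 :=
  Set.indicator_of_notMem (fun h' => hst (passType_disjoint h h')) _

/-- The excursion after the step down ends at `i` by type 0 or 1 and the path starts afresh there,
or it ends at `i + 1` by type 2 and is itself the passage, or it never ends and both sides are 0. -/
theorem passWt_down {l : ℤ} {z : ℤ → Fin 3 → ℂ} (hl : ∀ j < l, ∀ t, z j t = 1) {x : WalkPath}
    {i : ℤ} (hx : Legal x) (h0 : x 0 = i) (h1 : x 1 = i - 1) (t : Fin 3) :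
    passWt l z i t x = downWt l z i t (after 1 x) := by
  by_cases hy : ∃ σ, FirstPass (after 1 x) σ
  · obtain ⟨σ, hσ⟩ := hy
    obtain ⟨s, hs⟩ := exists_passType (hx.after 1) hσ
    simp only [after_apply, add_zero, h1] at hs
    obtain ⟨n, hn, hns, hnt⟩ := mem_passType.1 hs
    rw [sub_add_cancel] at hns hnt
    obtain rfl := hσ.unique hn
    by_cases hs2 : s = 2
    · subst hs2
      have hy0 : FirstPass x (1 + (n + 1)) := by
        have hnt' := hnt
        simp only [after_apply, backTo] at hnt'
        refine ⟨?_, fun m hm => ?_⟩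
        · rw [h0, hnt']; simp
        · rcases m.eq_zero_or_pos with rfl | hm0
          · rfl
          · have := hσ.2 (m - 1) (by omega)
            simp only [after_apply, add_zero, h1] at this
            rw [show 1 + (m - 1) = m by omega] at this
            omega
      -- The types shift with the level: the jump from `i - 1` to `i + 1` has type 2 above `i - 1`
      -- and type 1 above `i`.
      have hx1 : x ∈ passType i 1 := by
        refine mem_passType.2 ⟨1 + n, hy0, ?_, ?_⟩
        · have : x (1 + n) = i + backFrom 2 := hns
          rw [this]; simp [backFrom]; ring
        · have : x (1 + (n + 1)) = i + backTo 2 := hnt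
          rw [add_assoc, this]; simp [backTo]
      simp only [downWt, passWt_of_mem_of_ne hs (show (2 : Fin 3) ≠ 0 by decide),
        passWt_of_mem_of_ne hs (show (2 : Fin 3) ≠ 1 by decide), zero_mul, mul_zero, zero_add]
      by_cases ht : t = 1
      · subst ht
        rw [if_pos rfl, passWt_of_mem l z hx1, passWt_of_mem l z hs,
          wt_direct hl h0 h1 hσ hns hnt hy0]
      · rw [if_neg ht, passWt_of_mem_of_ne hx1 (Ne.symm ht)]
    · have hi : after 1 x (n + 1) = i := by
        rw [hnt]; revert hs2; fin_cases s <;> simp [backTo]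
      have key : passWt l z i t x = z i s * (passWt l z (i - 1) s (after 1 x)
          * passWt l z i t (after (n + 1) (after 1 x))) := by
        have hret := firstPass_return h0 h1 hσ hi
        by_cases hxt : x ∈ passType i t
        · obtain ⟨m, hm, hms, hmt⟩ := mem_passType.1 hxt
          obtain ⟨ρ, hρ⟩ := Nat.exists_eq_add_of_le (le_of_firstPass_return h0 h1 hσ hm)
          have hm' := hm
          rw [hρ] at hm'
          have hw := (hret ρ).1 hm'
          obtain ⟨r, rfl⟩ := Nat.exists_eq_succ_of_ne_zero hw.pos.ne'
          have hwt : after (n + 1) (after 1 x) ∈ passType i t := by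
            refine mem_passType.2 ⟨r, hw, ?_, ?_⟩
            · rw [← hms]; simp only [after_apply]; congr 1; omega
            · rw [← hmt]; simp only [after_apply]; congr 1; omega
          rw [passWt_of_mem l z hxt, passWt_of_mem l z hs, passWt_of_mem l z hwt, wt_return hl h0 h1 hσ hns hnt hm' hw, mul_assoc]
        · have hwt : after (n + 1) (after 1 x) ∉ passType i t := by
            intro hwt
            obtain ⟨r, hw, hms, hmt⟩ := mem_passType.1 hwt
            refine hxt (mem_passType.2 ⟨1 + (n + 1) + r, ?_, ?_, ?_⟩)
            · exact (hret (r + 1)).2 hw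
            · rw [← hms]; simp only [after_apply]; congr 1; omega
            · rw [← hmt]; simp only [after_apply]; congr 1; omega
          rw [passWt_of_notMem l z hxt, passWt_of_notMem l z hwt]
          simp
      rw [key, downWt, hσ.passTime]
      have h2 : passWt l z (i - 1) 2 (after 1 x) = 0 := passWt_of_mem_of_ne hs hs2
      rw [h2]
      fin_cases s
      · simp [passWt_of_mem_of_ne hs (show (0 : Fin 3) ≠ 1 by decide)]
      · simp [passWt_of_mem_of_ne hs (show (1 : Fin 3) ≠ 0 by decide)]
      · exact absurd rfl hs2
  · have hyn (s : Fin 3) : passWt l z (i - 1) s (after 1 x) = 0 := by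
      refine Set.indicator_of_notMem (fun h => hy ?_) _
      obtain ⟨m, hm, -⟩ := mem_passType.1 h
      exact ⟨_, hm⟩
    have hxn : passWt l z i t x = 0 := by
      refine Set.indicator_of_notMem (fun h => hy ?_) _
      obtain ⟨m, hm, -⟩ := mem_passType.1 h
      have h3 := hm.1
      refine exists_firstPass (n := m) ?_
      simp only [after_apply, add_zero, h1]
      rw [add_comm]
      omega
    simp [downWt, hyn, hxn]

/-- For `s ≠ 2` the passage above `i - 1` lands exactly at `i`, so the strong Markov property
restarts the walk at a fixed site. -/
theorem integral_passWt_mul {z : ℤ → Fin 3 → ℂ} (hz : ∀ j t, ‖z j t‖ ≤ 1) (ω : Env) (l i : ℤ)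
    {s : Fin 3} (hs : s ≠ 2) (t : Fin 3) :
    ∫ y, passWt l z (i - 1) s y * passWt l z i t (after (passTime y) y) ∂quenched ω (i - 1)
      = genFun ω l z (i - 1) s * genFun ω l z i t := by
  have h := strong_markov ω (i - 1) i (E := passType (i - 1) s) (Φ := wt l z (i - 1))
    (Ψ := passWt l z i t) (measurableSet_passType _ _) (measurable_wt _ _ _) (norm_wt_le hz _ _)
    (measurable_passWt _ _ _ _) (norm_passWt_le hz _ _ _) (fun x hx => by
      obtain ⟨n, hn, -, h2⟩ := mem_passType.1 hx
      refine ⟨n + 1, hn, ?_⟩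
      rw [h2]; revert hs; fin_cases s <;> simp [backTo])
    (fun x x' n hn hxx => ⟨passType_congr hn hxx, wt_congr hn hxx _ _ _⟩)
  rw [integral_passWt] at h
  rw [genFun, ← h, ← integral_indicator (measurableSet_passType _ _)]
  congr 1 with y
  by_cases hy : y ∈ passType (i - 1) s <;> simp [passWt, hy]

theorem integral_downWt {z : ℤ → Fin 3 → ℂ} (hz : ∀ j t, ‖z j t‖ ≤ 1) (ω : Env) (l i : ℤ)
    (t : Fin 3) :
    ∫ y, downWt l z i t y ∂quenched ω (i - 1)
      = (z i 0 * genFun ω l z (i - 1) 0 + z i 1 * genFun ω l z (i - 1) 1) * genFun ω l z i t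
        + if t = 1 then z i 2 * genFun ω l z (i - 1) 2 else 0 := by
  have hint (s : Fin 3) : Integrable (fun y => passWt l z (i - 1) s y
      * passWt l z i t (after (passTime y) y)) (quenched ω (i - 1)) :=
    integrable_of_norm_le_one ((measurable_passWt _ _ _ _).mul
      ((measurable_passWt _ _ _ _).comp measurable_after_passTime)) fun y => by
        rw [norm_mul]
        exact mul_le_one₀ (norm_passWt_le hz _ _ _ _) (norm_nonneg _) (norm_passWt_le hz _ _ _ _)
  have hint2 : Integrable (fun y => if t = 1 then z i 2 * passWt l z (i - 1) 2 y else 0)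
      (quenched ω (i - 1)) := by
    split_ifs
    · exact (integrable_of_norm_le_one (measurable_passWt _ _ _ _)
        (norm_passWt_le hz _ _ _)).const_mul _
    · exact integrable_zero _ _ _
  simp only [downWt]
  rw [integral_add (f := fun y =>
      z i 0 * (passWt l z (i - 1) 0 y * passWt l z i t (after (passTime y) y))
        + z i 1 * (passWt l z (i - 1) 1 y * passWt l z i t (after (passTime y) y)))
      (((hint 0).const_mul _).add ((hint 1).const_mul _)) hint2,
    integral_add ((hint 0).const_mul _) ((hint 1).const_mul _), integral_const_mul,
    integral_const_mul, integral_passWt_mul hz ω l i (by decide),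
    integral_passWt_mul hz ω l i (by decide)]
  congr 1
  · ring
  · split_ifs
    · rw [integral_const_mul, integral_passWt]
    · simp

theorem q_nonneg (ω : Env) (x : ℤ) : 0 ≤ q ω x := (ω x).2.1 0

theorem p₁_nonneg (ω : Env) (x : ℤ) : 0 ≤ p₁ ω x := (ω x).2.1 1

theorem p₂_nonneg (ω : Env) (x : ℤ) : 0 ≤ p₂ ω x := (ω x).2.1 2

theorem sum_weights (ω : Env) (x : ℤ) : q ω x + p₁ ω x + p₂ ω x = 1 := by
  have h := (ω x).2.2
  rwa [Fin.sum_univ_three] at h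

theorem quenched_first_step (ω : Env) (i c : ℤ) :
    quenched ω i {x | x 1 = c} = stepLaw ω i {c} := by
  have h := quenched_step ω i 0 (fun _ => i) {c}
  have h1 : quenched ω i {x | ∀ m ≤ 0, x m = i} = 1 := by
    rw [quenched_cylinder_zero ω i (fun _ => i)]; simp
  rw [h1, one_mul] at h
  rw [← h]
  refine measure_congr ?_
  filter_upwards [quenched_zero ω i] with x hx
  refine propext ⟨fun h => ?_, fun h => ?_⟩
  · exact ⟨fun m hm => by rw [Nat.le_zero.1 hm, hx], h⟩
  · exact h.2

theorem quenched_first_down (ω : Env) (i : ℤ) :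
    (quenched ω i).real {x | x 1 = i - 1} = q ω i := by
  rw [Measure.real, quenched_first_step]
  simp [stepLaw, show i + 1 ≠ i - 1 by omega, show i + 2 ≠ i - 1 by omega, q_nonneg]

theorem quenched_first_up_one (ω : Env) (i : ℤ) :
    (quenched ω i).real {x | x 1 = i + 1} = p₁ ω i := by
  rw [Measure.real, quenched_first_step]
  simp [stepLaw, show i - 1 ≠ i + 1 by omega, p₁_nonneg]

theorem quenched_first_up_two (ω : Env) (i : ℤ) :
    (quenched ω i).real {x | x 1 = i + 2} = p₂ ω i := by
  rw [Measure.real, quenched_first_step]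
  simp [stepLaw, show i - 1 ≠ i + 2 by omega, p₂_nonneg]

theorem passType_of_step_up {x : WalkPath} {i : ℤ} {s : Fin 3} (h0 : x 0 = i)
    (hs : backFrom s = -1) (h1 : x 1 = i + 1 + backTo s) (hb : 0 ≤ backTo s) :
    FirstPass x 1 ∧ x ∈ passType i s := by
  have h : FirstPass x 1 := ⟨by omega, fun m hm => by rw [Nat.lt_one_iff.1 hm]⟩
  exact ⟨h, mem_passType.2 ⟨0, h, by omega, h1⟩⟩

theorem setIntegral_step_up (ω : Env) (l : ℤ) (z : ℤ → Fin 3 → ℂ) (i : ℤ) {s : Fin 3}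
    (hs : backFrom s = -1) (hb : 0 ≤ backTo s) (t : Fin 3) :
    ∫ x in {x | x 1 = i + 1 + backTo s}, passWt l z i t x ∂quenched ω i
      = if t = s then ((quenched ω i).real {x | x 1 = i + 1 + backTo s} : ℂ) else 0 := by
  have hm : MeasurableSet {x : WalkPath | x 1 = i + 1 + backTo s} := by measurability
  rw [setIntegral_congr_ae (g := fun _ => if t = s then (1 : ℂ) else 0) hm]
  · split_ifs <;> simp
  · filter_upwards [quenched_zero ω i] with x h0 h1
    obtain ⟨h2, h3⟩ := passType_of_step_up h0 hs h1 hb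
    by_cases hts : t = s
    · subst hts
      rw [if_pos rfl, passWt_of_mem l z h3, wt_of_step_up z i h2]
    · rw [if_neg hts, passWt_of_mem_of_ne h3 (Ne.symm hts)]

/-- Decomposition at the first step and at the end of the excursion that it starts. -/
theorem genFun_rec {l : ℤ} {z : ℤ → Fin 3 → ℂ} (hz : ∀ j t, ‖z j t‖ ≤ 1)
    (hl : ∀ j < l, ∀ t, z j t = 1) (ω : Env) (i : ℤ) (t : Fin 3) :
    genFun ω l z i t = (if t = 0 then (p₁ ω i : ℂ) else 0) + (if t = 2 then (p₂ ω i : ℂ) else 0)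
      + q ω i * ((z i 0 * genFun ω l z (i - 1) 0 + z i 1 * genFun ω l z (i - 1) 1)
          * genFun ω l z i t + if t = 1 then z i 2 * genFun ω l z (i - 1) 2 else 0) := by
  have hint : Integrable (passWt l z i t) (quenched ω i) :=
    integrable_of_norm_le_one (measurable_passWt _ _ _ _) (norm_passWt_le hz _ _ _)
  have hm (c : ℤ) : MeasurableSet {x : WalkPath | x 1 = c} := by measurability
  have hdown : ∫ x in {x | x 1 = i - 1}, passWt l z i t x ∂quenched ω i
      = q ω i * ((z i 0 * genFun ω l z (i - 1) 0 + z i 1 * genFun ω l z (i - 1) 1)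
          * genFun ω l z i t + if t = 1 then z i 2 * genFun ω l z (i - 1) 2 else 0) := by
    have hdm : Measurable (downWt l z i t) := by
      unfold downWt
      have hp := measurable_passWt l z
      have hp2 : Measurable fun y => passWt l z i t (after (passTime y) y) :=
        (hp i t).comp measurable_after_passTime
      refine ((((hp _ _).mul hp2).const_mul _).add (((hp _ _).mul hp2).const_mul _)).add ?_
      split_ifs
      · exact (hp _ _).const_mul _
      · exact measurable_const
    rw [← integral_downWt hz, setIntegral_congr_ae (g := fun x => 1 * downWt l z i t (after 1 x))
      (hm _), integral_markov ω i (i - 1) 1 (g := fun _ => 1) (fun _ _ _ => rfl) hdm]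
    · simp [quenched_first_down]
    · filter_upwards [quenched_zero ω i, ae_legal ω i] with x h0 hx h1
      rw [one_mul, passWt_down hl hx h0 h1]
  have hup1 := setIntegral_step_up ω l z i (s := 0) rfl le_rfl t
  have hup2 := setIntegral_step_up ω l z i (s := 2) rfl (by simp [backTo]) t
  simp only [show backTo 0 = 0 from rfl, show backTo 2 = 1 from rfl, add_zero,
    show i + 1 + 1 = i + 2 by ring, quenched_first_up_one, quenched_first_up_two] at hup1 hup2
  have hcover : ∫ x, passWt l z i t x ∂quenched ω i
      = ∫ x in {x | x 1 = i + 1} ∪ {x | x 1 = i + 2} ∪ {x | x 1 = i - 1},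
          passWt l z i t x ∂quenched ω i := by
    rw [← setIntegral_univ]
    refine setIntegral_congr_set ?_
    filter_upwards [quenched_zero ω i, ae_legal ω i] with x h0 hx
    refine propext ⟨fun _ => ?_, fun _ => trivial⟩
    have := hx 0
    rw [h0] at this
    rcases this with h | h | h
    · exact Or.inr h
    · exact Or.inl (Or.inl h)
    · exact Or.inl (Or.inr h)
  rw [setIntegral_union ?_ (hm _) hint.integrableOn hint.integrableOn,
    setIntegral_union ?_ (hm _) hint.integrableOn hint.integrableOn, hup1, hup2, hdown,
    integral_passWt] at hcover
  · exact hcover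
  · refine Set.disjoint_left.2 fun x hx hx' => ?_
    simp only [Set.mem_ofPred_eq] at hx hx'
    omega
  · refine Set.disjoint_left.2 fun x hx hx' => ?_
    simp only [Set.mem_union, Set.mem_ofPred_eq] at hx hx'
    omega

/-! ### Solving the recursion -/

/-- Types 0 and 1 exclude each other on every path, so the bound is 1 and not 2. This is what gives
`‖retWt‖ ≤ q` in the next lemma. -/
theorem norm_return_le {z : ℤ → Fin 3 → ℂ} (hz : ∀ j t, ‖z j t‖ ≤ 1) (ω : Env) (l i j : ℤ) :
    ‖z j 0 * genFun ω l z i 0 + z j 1 * genFun ω l z i 1‖ ≤ 1 := by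
  have hint (s : Fin 3) : Integrable (passWt l z i s) (quenched ω i) :=
    integrable_of_norm_le_one (measurable_passWt _ _ _ _) (norm_passWt_le hz _ _ _)
  rw [← integral_passWt, ← integral_passWt, ← integral_const_mul, ← integral_const_mul,
    ← integral_add ((hint 0).const_mul _) ((hint 1).const_mul _)]
  refine (norm_integral_le_of_norm_le_const (C := 1) (.of_forall fun x => ?_)).trans (by simp)
  have h1 (s : Fin 3) : ‖z j s * passWt l z i s x‖ ≤ 1 := by
    rw [norm_mul]
    exact mul_le_one₀ (hz j s) (norm_nonneg _) (norm_passWt_le hz _ _ _ _)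
  by_cases h : x ∈ passType i 0
  · rw [passWt_of_mem_of_ne h (show (0 : Fin 3) ≠ 1 by decide), mul_zero, add_zero]
    exact h1 0
  · rw [passWt_of_notMem l z h, mul_zero, zero_add]
    exact h1 1

/-- The weight of an excursion down from `i` that returns to `i`. -/
noncomputable def retWt (ω : Env) (l : ℤ) (z : ℤ → Fin 3 → ℂ) (i : ℤ) : ℂ :=
  q ω i * (z i 0 * genFun ω l z (i - 1) 0 + z i 1 * genFun ω l z (i - 1) 1)

theorem one_sub_retWt_ne_zero {z : ℤ → Fin 3 → ℂ} (hz : ∀ j t, ‖z j t‖ ≤ 1) {ω : Env} {i : ℤ}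
    (hq : q ω i < 1) (l : ℤ) : 1 - retWt ω l z i ≠ 0 := by
  intro h
  have h1 : ‖retWt ω l z i‖ ≤ q ω i := by
    rw [retWt, norm_mul, Complex.norm_real, Real.norm_of_nonneg (q_nonneg ω i)]
    exact mul_le_of_le_one_right (q_nonneg ω i) (norm_return_le hz ω l (i - 1) i)
  rw [sub_eq_zero] at h
  rw [← h, norm_one] at h1
  linarith

/-- Each return to `i` reproduces the same unknown, so `genFun_rec` is linear in it; collecting
terms sums the geometric series of returning excursions. -/
theorem genFun_mul {l : ℤ} {z : ℤ → Fin 3 → ℂ} (hz : ∀ j t, ‖z j t‖ ≤ 1)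
    (hl : ∀ j < l, ∀ t, z j t = 1) (ω : Env) (i : ℤ) (t : Fin 3) :
    genFun ω l z i t * (1 - retWt ω l z i)
      = ![(p₁ ω i : ℂ), q ω i * (z i 2 * genFun ω l z (i - 1) 2), p₂ ω i] t := by
  have h := genFun_rec hz hl ω i t
  rw [retWt]
  fin_cases t
  · simp at h ⊢; linear_combination h
  · simp at h ⊢; linear_combination h
  · simp at h ⊢; linear_combination h

/-- The generating functions of level `i` depend on those of level `i - 1` only through their
products with the weights. -/
theorem genFun_congr {l l' : ℤ} {z z' : ℤ → Fin 3 → ℂ} (hz : ∀ j t, ‖z j t‖ ≤ 1)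
    (hl : ∀ j < l, ∀ t, z j t = 1) (hz' : ∀ j t, ‖z' j t‖ ≤ 1) (hl' : ∀ j < l', ∀ t, z' j t = 1)
    {ω : Env} {i : ℤ} (hq : q ω i < 1)
    (h : ∀ t, z i t * genFun ω l z (i - 1) t = z' i t * genFun ω l' z' (i - 1) t) (t : Fin 3) :
    genFun ω l z i t = genFun ω l' z' i t := by
  have h1 := genFun_mul hz hl ω i t
  have h2 := genFun_mul hz' hl' ω i t
  have hr : retWt ω l z i = retWt ω l' z' i := by simp only [retWt, h]
  rw [h 2, hr] at h1
  exact mul_right_cancel₀ (one_sub_retWt_ne_zero hz' hq l') (h1.trans h2.symm)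

/-! ### The probabilities of the types of first passage -/

/-- The probability that the first passage above `i`, starting at `i`, has type `t`. -/
noncomputable def passProb (ω : Env) (i : ℤ) (t : Fin 3) : ℝ := (quenched ω i).real (passType i t)

theorem passProb_nonneg (ω : Env) (i : ℤ) (t : Fin 3) : 0 ≤ passProb ω i t := measureReal_nonneg

theorem genFun_of_lt (ω : Env) {l i : ℤ} (h : i < l) (z : ℤ → Fin 3 → ℂ) (t : Fin 3) :
    genFun ω l z i t = passProb ω i t := by
  simp [genFun, wt, Finset.Icc_eq_empty (not_le.2 h), passProb]

theorem passProb_mul (ω : Env) (i : ℤ) (t : Fin 3) :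
    passProb ω i t * (1 - q ω i * (passProb ω (i - 1) 0 + passProb ω (i - 1) 1))
      = ![p₁ ω i, q ω i * passProb ω (i - 1) 2, p₂ ω i] t := by
  have h := genFun_mul (l := i + 1) (z := fun _ _ => 1) (by simp) (by simp) ω i t
  simp only [retWt, genFun_of_lt ω (show i < i + 1 by omega),
    genFun_of_lt ω (show i - 1 < i + 1 by omega), one_mul] at h
  revert h
  fin_cases t <;> simp only [Fin.zero_eta, Fin.mk_one, Fin.reduceFinMk, Matrix.cons_val] <;>
  · intro h
    exact_mod_cast h

theorem passProb_add_le (ω : Env) (i : ℤ) : passProb ω i 0 + passProb ω i 1 ≤ 1 := by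
  have hd : Disjoint (passType i 0) (passType i 1) :=
    Set.disjoint_left.2 fun x h0 h1 => absurd (passType_disjoint h0 h1) (by decide)
  rw [passProb, passProb, ← measureReal_union hd (measurableSet_passType _ _)]
  exact measureReal_le_one

/-- First exit from `(-∞, i]` at the point `y`, through positions with the property `p`. -/
theorem exists_pass_iff {x : WalkPath} (hx : Legal x) {i : ℤ} (h0 : x 0 = i) (p : ℤ → Prop)
    (y : ℤ) (hy : i < y) :
    (∃ n, x n = y ∧ ∀ m < n, p (x m) ∧ x m ≤ i) ↔
      (∃ t, x ∈ passType i t ∧ i + 1 + backTo t = y) ∧ ∀ n, FirstPass x n → ∀ m < n, p (x m) := by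
  constructor
  · rintro ⟨n, hn, h⟩
    have hf : FirstPass x n := ⟨by omega, fun m hm => by rw [h0]; exact (h m hm).2⟩
    refine ⟨?_, fun n' hn' m hm => (h m (by rw [hf.unique hn']; exact hm)).1⟩
    obtain ⟨t, ht⟩ := exists_passType hx hf
    rw [h0] at ht
    refine ⟨t, ht, ?_⟩
    obtain ⟨m, hm, -, hmt⟩ := mem_passType.1 ht
    rw [← hmt, ← hn, hf.unique hm]
  · rintro ⟨⟨t, ht, hty⟩, h⟩
    obtain ⟨m, hm, -, hmt⟩ := mem_passType.1 ht
    exact ⟨m + 1, by rw [hmt, hty], fun k hk => ⟨h _ hm k hk, by rw [← h0]; exact hm.2 k hk⟩⟩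

theorem exists_type_one {i : ℤ} {x : WalkPath} :
    (∃ t, x ∈ passType i t ∧ i + 1 + backTo t = i + 1) ↔ x ∈ passType i 0 ∪ passType i 1 := by
  simp [backTo, Fin.exists_fin_succ]

theorem exists_type_two {i : ℤ} {x : WalkPath} :
    (∃ t, x ∈ passType i t ∧ i + 1 + backTo t = i + 2) ↔ x ∈ passType i 2 := by
  simp [backTo, Fin.exists_fin_succ, show i + 1 + 1 = i + 2 by ring, show i + 1 ≠ i + 2 by omega]

/-- Paths that, up to the first passage, stay in `[a, ∞)`. -/
def staysAbove (a : ℤ) : Set WalkPath := {x | ∀ n, FirstPass x n → ∀ m < n, a ≤ x m}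

theorem measurableSet_staysAbove (a : ℤ) : MeasurableSet (staysAbove a) := by
  have : staysAbove a = ⋂ n, ({x | FirstPass x n}ᶜ ∪ {x | ∀ m < n, a ≤ x m}) := by
    ext x
    simp only [staysAbove, Set.mem_ofPred_eq, Set.mem_iInter, Set.mem_union, Set.mem_compl_iff]
    exact forall_congr' fun n => imp_iff_not_or
  rw [this]
  refine MeasurableSet.iInter fun n => (measurableSet_firstPass n).compl.union ?_
  measurability

theorem exitProb_one (ω : Env) (i : ℤ) :
    exitProb ω i i (i + 1) = passProb ω i 0 + passProb ω i 1 := by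
  have hd : Disjoint (passType i 0) (passType i 1) :=
    Set.disjoint_left.2 fun x h0 h1 => absurd (passType_disjoint h0 h1) (by decide)
  rw [passProb, passProb, ← measureReal_union hd (measurableSet_passType _ _), exitProb]
  refine measureReal_congr ?_
  filter_upwards [ae_legal ω i, quenched_zero ω i] with x hx h0
  have h := exists_pass_iff hx h0 (fun _ => True) (i + 1) (by omega)
  rw [exists_type_one] at h
  simp only [true_and, implies_true, and_true] at h
  exact propext h

theorem exitProb_two (ω : Env) (i : ℤ) : exitProb ω i i (i + 2) = passProb ω i 2 := by
  rw [passProb, exitProb]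
  refine measureReal_congr ?_
  filter_upwards [ae_legal ω i, quenched_zero ω i] with x hx h0
  have h := exists_pass_iff hx h0 (fun _ => True) (i + 2) (by omega)
  rw [exists_type_two] at h
  simp only [true_and, implies_true, and_true] at h
  exact propext h

theorem exitProbBefore_one (ω : Env) (a i : ℤ) :
    exitProbBefore ω i a i (i + 1) = (quenched ω i).real (passType i 0 ∩ staysAbove a)
      + (quenched ω i).real (passType i 1 ∩ staysAbove a) := by
  have hd : Disjoint (passType i 0 ∩ staysAbove a) (passType i 1 ∩ staysAbove a) :=
    Set.disjoint_left.2 fun x h0 h1 => absurd (passType_disjoint h0.1 h1.1) (by decide)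
  rw [← measureReal_union hd ((measurableSet_passType _ _).inter (measurableSet_staysAbove _)),
    exitProbBefore, ← Set.union_inter_distrib_right]
  refine measureReal_congr ?_
  filter_upwards [ae_legal ω i, quenched_zero ω i] with x hx h0
  have h := exists_pass_iff hx h0 (a ≤ ·) (i + 1) (by omega)
  rw [exists_type_one] at h
  exact propext h

theorem exitProbBefore_two (ω : Env) (a i : ℤ) :
    exitProbBefore ω i a i (i + 2) = (quenched ω i).real (passType i 2 ∩ staysAbove a) := by
  rw [exitProbBefore]
  refine measureReal_congr ?_
  filter_upwards [ae_legal ω i, quenched_zero ω i] with x hx h0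
  have h := exists_pass_iff hx h0 (a ≤ ·) (i + 2) (by omega)
  rw [exists_type_two] at h
  exact propext h

/-! ### Exit from an interval -/

/-- The weight that kills the steps down from `a`. -/
def killAt (a : ℤ) : ℤ → Fin 3 → ℂ := fun j _ => if j = a then 0 else 1

/-- Steps down have length one, so a path that gets below `a` first does so by a step from `a` to `a
- 1`. It must cross back by time `τ`, by one of the three types, and hence this step is counted. -/
theorem forall_cnt_eq_zero_iff {x : WalkPath} (hx : Legal x) {a : ℤ} (ha : a ≤ x 0) {τ : ℕ}
    (hτ : FirstPass x τ) : (∀ t, cnt x a t = 0) ↔ ∀ m < τ, a ≤ x m := by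
  classical
  simp only [cnt_eq hτ, Set.ncard_eq_zero (downs_finite _ _ _ _ _)]
  constructor
  · intro h
    by_contra! hex
    have hex' : ∃ m, x m < a := hex.imp fun m hm => hm.2
    obtain ⟨m₁, hm₁, hm₁'⟩ := hex
    -- `m₀` is the first time below `a`, and `r` below is the first time back in `[a, ∞)`.
    set m₀ := Nat.find hex' with hm₀
    have h1 : x m₀ < a := Nat.find_spec hex'
    have hm₀τ : m₀ < τ := (Nat.find_min' hex' hm₁').trans_lt hm₁
    obtain ⟨n, hn⟩ : ∃ n, m₀ = n + 1 := by
      refine Nat.exists_eq_succ_of_ne_zero fun h0 => ?_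
      rw [h0] at h1
      omega
    have h2 : a ≤ x n := not_lt.1 (Nat.find_min hex' (by omega))
    rw [hn] at h1
    have h3 : x n = a ∧ x (n + 1) = a - 1 := by
      rcases hx n with h | h | h <;> omega
    have hback : ∃ r, n + 1 < r ∧ a ≤ x r := by
      refine ⟨τ, by omega, ?_⟩
      have := hτ.1
      omega
    set r := Nat.find hback with hr
    obtain ⟨hr1, hr2⟩ := Nat.find_spec hback
    rw [← hr] at hr1 hr2
    have hrτ : r ≤ τ := Nat.find_min' hback ⟨by omega, by have := hτ.1; omega⟩
    obtain ⟨m, hm⟩ : ∃ m, r = m + 1 := Nat.exists_eq_succ_of_ne_zero (by omega)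
    have hlt (k : ℕ) (hk : n < k) (hkm : k ≤ m) : x k < a := by
      by_cases hk1 : k = n + 1
      · rw [hk1]; exact h1
      · by_contra hka
        exact Nat.find_min hback (show k < r by omega) ⟨by omega, not_lt.1 hka⟩
    have hmem (s t : ℤ) (hs : x m = s) (ht : x (m + 1) = t) : n ∈ downs x τ a s t :=
      ⟨h3.1, h3.2, m, by omega, by omega, hlt, hs, by rw [← hm]; exact hr2, ht⟩
    have hxm := hlt m (by omega) le_rfl
    rw [hm] at hr2
    have hne (t : Fin 3) : ¬ (x m = a + backFrom t ∧ x (m + 1) = a + backTo t) := fun hst => by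
      have := hmem _ _ hst.1 hst.2
      rw [h t] at this
      exact this
    have hn0 := hne 0
    have hn1 := hne 1
    have hn2 := hne 2
    simp only [backFrom, backTo, Matrix.cons_val] at hn0 hn1 hn2
    rcases hx m with h | h | h <;> omega
  · rintro h t
    refine Set.eq_empty_of_forall_notMem ?_
    rintro n ⟨-, h1, m, h2, h3, -⟩
    have := h (n + 1) (by omega)
    omega

/-- With 0 ^ 0 = 1, the weight 0 at `a` is the indicator of having no counted step down from `a`. -/
theorem wt_killAt {x : WalkPath} (hx : Legal x) {a i : ℤ} (h0 : x 0 = i) (ha : a ≤ i) {τ : ℕ}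
    (hτ : FirstPass x τ) : wt a (killAt a) i x = (staysAbove a).indicator 1 x := by
  have h1 : wt a (killAt a) i x = ∏ t, (0 : ℂ) ^ cnt x a t := by
    rw [wt, Finset.prod_eq_single_of_mem a (Finset.mem_Icc.2 ⟨le_rfl, ha⟩)]
    · simp [killAt]
    · intro j _ hj
      simp [killAt, hj]
  have h2 : x ∈ staysAbove a ↔ ∀ m < τ, a ≤ x m :=
    ⟨fun h => h τ hτ, fun h n hn => by rwa [← hτ.unique hn]⟩
  rw [← forall_cnt_eq_zero_iff hx (by omega) hτ] at h2
  rw [h1]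
  by_cases h : ∀ t, cnt x a t = 0
  · rw [Set.indicator_of_mem (h2.2 h)]
    simp [h]
  · rw [Set.indicator_of_notMem (mt h2.1 h)]
    push Not at h
    obtain ⟨t, ht⟩ := h
    exact Finset.prod_eq_zero (Finset.mem_univ t) (zero_pow ht)

theorem genFun_killAt (ω : Env) {a i : ℤ} (ha : a ≤ i) (t : Fin 3) :
    genFun ω a (killAt a) i t = (quenched ω i).real (passType i t ∩ staysAbove a) := by
  rw [genFun, setIntegral_congr_ae (g := (staysAbove a).indicator 1) (measurableSet_passType _ _),
    setIntegral_indicator (measurableSet_staysAbove a)]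
  · simp
  · filter_upwards [ae_legal ω i, quenched_zero ω i] with x hx h0 h
    obtain ⟨n, hn, -⟩ := mem_passType.1 h
    exact wt_killAt hx h0 ha hn

theorem norm_killAt_le (a j : ℤ) (t : Fin 3) : ‖killAt a j t‖ ≤ 1 := by
  unfold killAt; split_ifs <;> simp

theorem killAt_of_lt {a j : ℤ} (h : j < a) (t : Fin 3) : killAt a j t = 1 := by
  simp [killAt, h.ne]

theorem exitProbBefore_self (ω : Env) (i : ℤ) :
    exitProbBefore ω i i i (i + 1) = p₁ ω i ∧ exitProbBefore ω i i i (i + 2) = p₂ ω i := by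
  have h (t : Fin 3) := genFun_mul (norm_killAt_le i) (fun j => killAt_of_lt) ω i t
  simp only [retWt, genFun_killAt ω le_rfl] at h
  rw [exitProbBefore_one, exitProbBefore_two]
  have h0 := h 0
  have h1 := h 1
  have h2 := h 2
  simp [killAt] at h0 h1 h2
  rw [h0, h1, h2]
  simp

/-- For `a < i` the killing weight is 1 at level `i`. Types 0 and 1 both land at `i + 1` and are
added; the type 2 term of level `i - 1` is exit at `i + 1` from one level below. -/
theorem exitProbBefore_rec (ω : Env) {a i : ℤ} (ha : a < i) :
    exitProbBefore ω i a i (i + 1) * (1 - q ω i * exitProbBefore ω (i - 1) a (i - 1) i)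
        = p₁ ω i + q ω i * exitProbBefore ω (i - 1) a (i - 1) (i + 1) ∧
      exitProbBefore ω i a i (i + 2) * (1 - q ω i * exitProbBefore ω (i - 1) a (i - 1) i)
        = p₂ ω i := by
  have h (t : Fin 3) := genFun_mul (norm_killAt_le a) (fun j => killAt_of_lt) ω i t
  have e1 := exitProbBefore_one ω a (i - 1)
  have e2 := exitProbBefore_two ω a (i - 1)
  rw [sub_add_cancel] at e1
  rw [show i - 1 + 2 = i + 1 by ring] at e2
  simp only [retWt, genFun_killAt ω ha.le, genFun_killAt ω (show a ≤ i - 1 by omega), killAt,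
    if_neg ha.ne', one_mul] at h
  rw [exitProbBefore_one, exitProbBefore_two, e1, e2]
  have h0 := h 0
  have h1 := h 1
  have h2 := h 2
  simp only [Matrix.cons_val] at h0 h1 h2
  norm_cast at h0 h1 h2
  exact ⟨by rw [add_mul, h0, h1], h2⟩

theorem exitProbBefore_nonneg (ω : Env) (k a b y : ℤ) : 0 ≤ exitProbBefore ω k a b y :=
  measureReal_nonneg

theorem exitProbBefore_le_one (ω : Env) (k a b y : ℤ) : exitProbBefore ω k a b y ≤ 1 :=
  measureReal_le_one

/-- Every product in the sum ends with `M ω i`. Factoring it out on the right passes from `i` to `i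
- 1` with the lower endpoint fixed, as in `exitProbBefore_rec`. -/
theorem sumM_succ (ω : Env) (i : ℤ) (n : ℕ) :
    sumM ω i (n + 1) = (1 + sumM ω (i - 1) n) * M ω i := by
  have hp (m : ℕ) : prodM ω i (m + 1) = prodM ω (i - 1) m * M ω i := by
    induction m with
    | zero => simp [prodM]
    | succ m ih =>
      rw [prodM, ih, prodM, ← mul_assoc]
      congr 3
      push_cast; ring
  rw [sumM, Finset.sum_range_succ', sumM, add_mul, Finset.sum_mul, one_mul, add_comm]
  simp only [hp]
  rfl

/-- The explicit exit probabilities from an interval. -/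
theorem exitProbBefore_formula {ω : Env} (hq : ∀ i, 0 < q ω i) (hq1 : ∀ i, q ω i < 1) (n : ℕ) :
    ∀ i : ℤ, 0 < 1 + sumM ω i n 0 0 ∧
      exitProbBefore ω i (i - n) i (i + 1)
        = (sumM ω i n 0 0 - sumM ω i n 0 1) / (1 + sumM ω i n 0 0) ∧
      exitProbBefore ω i (i - n) i (i + 2) = sumM ω i n 0 1 / (1 + sumM ω i n 0 0) := by
  induction n with
  | zero =>
    intro i
    have h := exitProbBefore_self ω i
    have hs := sum_weights ω i
    have h1 := p₁_nonneg ω i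
    have h2 := p₂_nonneg ω i
    have hqi := hq i
    have e : 1 + (p₁ ω i + p₂ ω i) / q ω i = 1 / q ω i := by
      field_simp; linarith
    simp only [Nat.cast_zero, sub_zero, h.1, h.2, sumM, zero_add, Finset.sum_range_one, prodM, M,
      Matrix.of_apply, Matrix.cons_val', Matrix.cons_val_zero, Matrix.cons_val_one, e]
    refine ⟨by positivity, ?_, ?_⟩
    · field_simp; ring
    · field_simp
  | succ n ih =>
    intro i
    obtain ⟨hpos, ih1, ih2⟩ := ih (i - 1)
    rw [sub_add_cancel] at ih1
    rw [show i - 1 + 2 = i + 1 by ring] at ih2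
    obtain ⟨hr1, hr2⟩ := exitProbBefore_rec ω (a := i - (n + 1 : ℕ)) (i := i) (by push_cast; omega)
    have ea : i - 1 - (n : ℤ) = i - (n + 1 : ℕ) := by push_cast; ring
    rw [ea] at ih1 ih2
    set S := sumM ω (i - 1) n with hS
    have e00 : sumM ω i (n + 1) 0 0 = (1 + S 0 0) * ((p₁ ω i + p₂ ω i) / q ω i) + S 0 1 := by
      rw [sumM_succ]; simp [Matrix.mul_apply, M, Fin.sum_univ_two, ← hS]
    have e01 : sumM ω i (n + 1) 0 1 = (1 + S 0 0) * (p₂ ω i / q ω i) := by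
      rw [sumM_succ]; simp [Matrix.mul_apply, M, Fin.sum_univ_two, ← hS]
    have hle := exitProbBefore_le_one ω (i - 1) (i - (n + 1 : ℕ)) (i - 1) i
    have hge := exitProbBefore_nonneg ω (i - 1) (i - (n + 1 : ℕ)) (i - 1) i
    set E1 := exitProbBefore ω (i - 1) (i - (n + 1 : ℕ)) (i - 1) i with hE1
    set E2 := exitProbBefore ω (i - 1) (i - (n + 1 : ℕ)) (i - 1) (i + 1) with hE2
    have hqi := hq i
    have hD : 0 < 1 - q ω i * E1 := by nlinarith [hq1 i]
    rw [eq_div_iff hpos.ne'] at ih1 ih2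
    have hs := sum_weights ω i
    -- The denominators of the two levels differ exactly by the factor `1 - q E₁` of the recursion,
    -- divided by `q`.
    have key : 1 + sumM ω i (n + 1) 0 0 = (1 + S 0 0) * (1 - q ω i * E1) / q ω i := by
      rw [e00]; field_simp
      linear_combination (1 + S 0 0) * hs + q ω i * ih1
    refine ⟨by rw [key]; positivity, ?_, ?_⟩
    · rw [key, eq_div_iff (by positivity), e00, e01]
      field_simp
      linear_combination (1 + S 0 0) * hr1 + q ω i * ih2
    · rw [key, eq_div_iff (by positivity), e01]
      field_simp
      linear_combination hr2

theorem tendsto_exitProbBefore (ω : Env) (i y : ℤ) :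
    Tendsto (fun n : ℕ => exitProbBefore ω i (i - n) i y) atTop (𝓝 (exitProb ω i i y)) := by
  have hmono : Monotone fun n : ℕ =>
      {x : WalkPath | ∃ k, x k = y ∧ ∀ m < k, i - (n : ℤ) ≤ x m ∧ x m ≤ i} := by
    rintro n n' hn x ⟨k, hk, h⟩
    exact ⟨k, hk, fun m hm => ⟨by have := (h m hm).1; omega, (h m hm).2⟩⟩
  have h := tendsto_measure_iUnion_atTop (μ := quenched ω i) hmono
  have hU : (⋃ n : ℕ, {x : WalkPath | ∃ k, x k = y ∧ ∀ m < k, i - (n : ℤ) ≤ x m ∧ x m ≤ i})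
      = {x | ∃ k, x k = y ∧ ∀ m < k, x m ≤ i} := by
    ext x
    simp only [Set.mem_iUnion, Set.mem_ofPred_eq]
    constructor
    · rintro ⟨n, k, hk, h⟩
      exact ⟨k, hk, fun m hm => (h m hm).2⟩
    · rintro ⟨k, hk, h⟩
      -- The sum of the depths before time `k` dominates each of them, and so serves as one common
      -- bound.
      refine ⟨∑ m ∈ Finset.range k, (i - x m).toNat, k, hk, fun m hm => ⟨?_, h m hm⟩⟩
      have := Finset.single_le_sum (f := fun m => (i - x m).toNat) (fun _ _ => Nat.zero_le _)
        (Finset.mem_range.2 hm)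
      omega
  rw [hU] at h
  exact (ENNReal.tendsto_toReal (measure_ne_top _ _)).comp h

theorem sum_passProb {ω : Env} {i : ℤ} (h : ∀ᵐ x ∂quenched ω i, T₁ x < ⊤) :
    passProb ω i 0 + passProb ω i 1 + passProb ω i 2 = 1 := by
  have hd (s t : Fin 3) (hst : s ≠ t) : Disjoint (passType i s) (passType i t) :=
    Set.disjoint_left.2 fun x h0 h1 => hst (passType_disjoint h0 h1)
  have h1 : (quenched ω i).real (passType i 0 ∪ passType i 1 ∪ passType i 2) = 1 := by
    rw [← probReal_univ (μ := quenched ω i)]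
    refine measureReal_congr ?_
    filter_upwards [h, ae_legal ω i, quenched_zero ω i] with x hT hx h0
    refine propext ⟨fun _ => trivial, fun _ => ?_⟩
    obtain ⟨n, hn⟩ := T₁_lt_top_iff.1 hT
    obtain ⟨t, ht⟩ := exists_passType hx hn
    rw [h0] at ht
    fin_cases t
    · exact Or.inl (Or.inl ht)
    · exact Or.inl (Or.inr ht)
    · exact Or.inr ht
  rw [measureReal_union ((hd _ _ (by decide)).union_left (hd _ _ (by decide)))
    (measurableSet_passType _ _), measureReal_union (hd _ _ (by decide))
    (measurableSet_passType _ _)] at h1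
  exact h1

/-! ### The offspring parameters -/

theorem gam_eq (ω : Env) (i : ℤ) : gam ω i = q ω i * passProb ω (i - 1) 2 := by
  rw [gam, ← exitProb_two, show i - 1 + 2 = i + 1 by ring]

theorem q_lt_one {ω : Env} (hp₁ : ∀ i, 0 < p₁ ω i) (i : ℤ) : q ω i < 1 := by
  have := sum_weights ω i
  have := hp₁ i
  have := p₂_nonneg ω i
  linarith

theorem one_sub_return_pos {ω : Env} (hp₁ : ∀ i, 0 < p₁ ω i) (i : ℤ) :
    0 < 1 - q ω i * (passProb ω (i - 1) 0 + passProb ω (i - 1) 1) := by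
  have h1 := passProb_add_le ω (i - 1)
  have h2 := mul_le_of_le_one_right (q_nonneg ω i) h1
  have := q_lt_one hp₁ i
  linarith

/-- By `passProb_mul`, types 0 and 1 have a common denominator and the numerators p₁ and γ. The
fractions in the definitions of α and β therefore split the probability of exit at `i` into these
two types. -/
theorem alp_bet_eq {ω : Env} (hp₁ : ∀ i, 0 < p₁ ω i) (i : ℤ) :
    alp ω i = q ω i * passProb ω (i - 1) 0 ∧ bet ω i = q ω i * passProb ω (i - 1) 1 := by
  have h0 := passProb_mul ω (i - 1) 0
  have h1 := passProb_mul ω (i - 1) 1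
  simp only [Matrix.cons_val] at h0 h1
  have hpos := one_sub_return_pos hp₁ (i - 1)
  have he := exitProb_one ω (i - 1)
  rw [sub_add_cancel] at he
  rw [alp, bet, he, gam_eq, ← h0, ← h1]
  have hp := hp₁ (i - 1)
  set D := 1 - q ω (i - 1) * (passProb ω (i - 1 - 1) 0 + passProb ω (i - 1 - 1) 1) with hD
  have h3 : 0 < passProb ω (i - 1) 0 := by
    rw [← h0] at hp
    exact (pos_iff_pos_of_mul_pos hp).2 hpos
  have h4 := passProb_nonneg ω (i - 1) 1
  have h5 : 0 < passProb ω (i - 1) 0 + passProb ω (i - 1) 1 := by linarith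
  rw [← add_mul]
  constructor <;> field_simp

theorem one_sub_alp_bet_pos {ω : Env} (hp₁ : ∀ i, 0 < p₁ ω i) (i : ℤ) : 0 < 1 - alp ω i - bet ω i := by
  have h := one_sub_return_pos hp₁ i
  rw [(alp_bet_eq hp₁ i).1, (alp_bet_eq hp₁ i).2]
  linarith

theorem passProb_eq {ω : Env} (hp₁ : ∀ i, 0 < p₁ ω i) (i : ℤ) (t : Fin 3) :
    passProb ω i t = ![p₁ ω i, gam ω i, p₂ ω i] t / (1 - alp ω i - bet ω i) := by
  rw [eq_div_iff (one_sub_alp_bet_pos hp₁ i).ne', gam_eq, ← passProb_mul ω i t,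
    (alp_bet_eq hp₁ i).1, (alp_bet_eq hp₁ i).2]
  ring

theorem passProb_pos {ω : Env} (hq : ∀ i, 0 < q ω i) (hp₁ : ∀ i, 0 < p₁ ω i)
    (hp₂ : ∀ i, 0 < p₂ ω i) (i : ℤ) (t : Fin 3) : 0 < passProb ω i t := by
  -- Type 2 is settled at all levels first, since type 1 at `i` needs it at `i - 1`.
  have h2 (j : ℤ) : 0 < passProb ω j 2 := by
    rw [passProb_eq hp₁ j 2]
    exact div_pos (hp₂ j) (one_sub_alp_bet_pos hp₁ j)
  rw [passProb_eq hp₁ i t]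
  refine div_pos ?_ (one_sub_alp_bet_pos hp₁ i)
  fin_cases t
  · exact hp₁ i
  · change 0 < gam ω i
    rw [gam_eq]
    exact mul_pos (hq i) (h2 _)
  · exact hp₂ i

theorem alp_bet_pos {ω : Env} (hq : ∀ i, 0 < q ω i) (hp₁ : ∀ i, 0 < p₁ ω i)
    (hp₂ : ∀ i, 0 < p₂ ω i) (i : ℤ) : 0 < alp ω i ∧ 0 < bet ω i := by
  rw [(alp_bet_eq hp₁ i).1, (alp_bet_eq hp₁ i).2]
  exact ⟨mul_pos (hq i) (passProb_pos hq hp₁ hp₂ _ _),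
    mul_pos (hq i) (passProb_pos hq hp₁ hp₂ _ _)⟩

/-! ### Measures on counts are determined by their generating functions -/

/-- The monomial with exponents `v`, at the weights `b`. -/
noncomputable def monom {ι : Type*} [Fintype ι] (b : ι → ℂ) (v : ι → ℕ) : ℂ := ∏ i, b i ^ v i

theorem measurable_monom {ι : Type*} [Fintype ι] (b : ι → ℂ) : Measurable (monom b) :=
  measurable_of_countable _

theorem norm_monom_le {ι : Type*} [Fintype ι] {b : ι → ℂ} (hb : ∀ i, ‖b i‖ ≤ 1) (v : ι → ℕ) :
    ‖monom b v‖ ≤ 1 := by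
  rw [monom, norm_prod]
  refine Finset.prod_le_one (fun _ _ => norm_nonneg _) fun i _ => ?_
  rw [norm_pow]
  exact pow_le_one₀ (norm_nonneg _) (hb i)

/-- At weights exp(i s_j) on the unit circle the monomial in `v` is exp(i ⟨s, v⟩), so the integrals
give the characteristic function of the image measure in Euclidean space. -/
theorem ext_of_integral_monom {ι : Type*} [Fintype ι] {μ ν : Measure (ι → ℕ)} [IsFiniteMeasure μ]
    [IsFiniteMeasure ν]
    (h : ∀ b : ι → ℂ, (∀ i, ‖b i‖ ≤ 1) → ∫ v, monom b v ∂μ = ∫ v, monom b v ∂ν) : μ = ν := by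
  set T : (ι → ℕ) → EuclideanSpace ℝ ι := fun v => WithLp.toLp 2 fun i => (v i : ℝ) with hT
  have hTm : Measurable T := measurable_of_countable _
  have hTi : Function.Injective T := by
    intro v w hvw
    ext i
    have := congrArg (fun u : EuclideanSpace ℝ ι => u i) hvw
    simpa [hT] using this
  have hchar (ρ : Measure (ι → ℕ)) (s : EuclideanSpace ℝ ι) :
      charFun (ρ.map T) s = ∫ v, monom (fun i => Complex.exp (s i * Complex.I)) v ∂ρ := by
    rw [charFun_apply, integral_map hTm.aemeasurable (by fun_prop)]
    refine integral_congr_ae (.of_forall fun v => ?_)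
    simp only [monom, ← Complex.exp_nat_mul, ← Complex.exp_sum]
    congr 1
    simp only [hT, PiLp.inner_apply, RCLike.inner_apply, conj_trivial, Complex.ofReal_sum,
      Finset.sum_mul]
    refine Finset.sum_congr rfl fun i _ => ?_
    push_cast
    ring
  have hmap : μ.map T = ν.map T := by
    refine Measure.ext_of_charFun (funext fun s => ?_)
    rw [hchar, hchar]
    exact h _ fun i => by rw [Complex.norm_exp_ofReal_mul_I]
  refine Measure.ext_of_singleton fun v => ?_
  have h1 := congrArg (fun ρ => ρ {T v}) hmap
  rwa [Measure.map_apply hTm (measurableSet_singleton _),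
    Measure.map_apply hTm (measurableSet_singleton _), ← Set.image_singleton,
    hTi.preimage_image] at h1

/-- Joint laws of finitely many generations and one more. -/
theorem ext_of_integral_monom_mul {ι : Type*} [Fintype ι] {n : ℕ}
    {μ ν : Measure ((Fin n → ι → ℕ) × (ι → ℕ))} [IsFiniteMeasure μ] [IsFiniteMeasure ν]
    (h : ∀ b : ℕ → ι → ℂ, (∀ k i, ‖b k i‖ ≤ 1) →
      ∫ p, (∏ k : Fin n, monom (b k) (p.1 k)) * monom (b n) p.2 ∂μ
        = ∫ p, (∏ k : Fin n, monom (b k) (p.1 k)) * monom (b n) p.2 ∂ν) : μ = ν := by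
  set g : (Fin n → ι → ℕ) × (ι → ℕ) → ((Fin n × ι) ⊕ ι) → ℕ :=
    fun p => Sum.elim (fun ki => p.1 ki.1 ki.2) p.2 with hg
  have hgm : Measurable g := measurable_of_countable _
  have hgi : Function.Injective g := by
    rintro ⟨a, b⟩ ⟨a', b'⟩ hp
    have h1 (k : Fin n) (i : ι) : a k i = a' k i := congrFun hp (Sum.inl (k, i))
    have h2 (i : ι) : b i = b' i := congrFun hp (Sum.inr i)
    ext k i
    · exact h1 k i
    · exact h2 k
  have hmap : μ.map g = ν.map g := by
    refine ext_of_integral_monom fun b hb => ?_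
    rw [integral_map hgm.aemeasurable (measurable_monom b).aestronglyMeasurable,
      integral_map hgm.aemeasurable (measurable_monom b).aestronglyMeasurable]
    -- The indices below `n` carry the weights of the first block; of the others only `n` is ever
    -- read, and it carries those of the second block.
    have h1 := h (fun k i => if hk : k < n then b (Sum.inl (⟨k, hk⟩, i)) else b (Sum.inr i))
      (fun k i => by split_ifs <;> exact hb _)
    simpa [monom, hg, Fintype.prod_sum_type, Fintype.prod_prod_type] using h1
  refine Measure.ext_of_singleton fun v => ?_
  have h1 := congrArg (fun ρ => ρ {g v}) hmap
  rwa [Measure.map_apply hgm (measurableSet_singleton _),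
    Measure.map_apply hgm (measurableSet_singleton _), ← Set.image_singleton,
    hgi.preimage_image] at h1

/-! ### The next generation -/

theorem measurable_sum_counts {ι κ : Type*} [Fintype ι] [Fintype κ] :
    Measurable fun ξ : κ → ι → ℕ => ∑ j, ξ j := measurable_of_countable _

theorem isProbabilityMeasure_nextGeneration {ι : Type*} [Fintype ι]
    {off : ι → Measure (ι → ℕ)} [∀ t, IsProbabilityMeasure (off t)] (u : ι → ℕ) :
    IsProbabilityMeasure (nextGeneration off u) :=
  Measure.isProbabilityMeasure_map measurable_sum_counts.aemeasurable

/-- A monomial turns the sum over individuals into a product, and independence turns its integral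
into a product of offspring generating functions. As a function of `u` the result is again a
monomial. -/
theorem integral_monom_nextGeneration {ι : Type*} [Fintype ι]
    {off : ι → Measure (ι → ℕ)} [∀ t, IsProbabilityMeasure (off t)] (u : ι → ℕ) (b : ι → ℂ) :
    ∫ v, monom b v ∂nextGeneration off u = monom (fun t => ∫ v, monom b v ∂off t) u := by
  rw [nextGeneration, integral_map measurable_sum_counts.aemeasurable
    (measurable_monom b).aestronglyMeasurable]
  have h (ξ : (t : ι) × Fin (u t) → ι → ℕ) : monom b (∑ j, ξ j) = ∏ j, monom b (ξ j) := by
    simp only [monom, Finset.sum_apply]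
    rw [Finset.prod_comm]
    simp only [Finset.prod_pow_eq_pow_sum]
  simp only [h]
  rw [integral_fintype_prod_eq_prod (fun _ => monom b), monom, Fintype.prod_sigma]
  simp

theorem nextGeneration_single {ι : Type*} [Fintype ι] [DecidableEq ι]
    {off : ι → Measure (ι → ℕ)} [∀ t, IsProbabilityMeasure (off t)] (t : ι) :
    nextGeneration off (Pi.single t 1) = off t := by
  have := isProbabilityMeasure_nextGeneration (off := off) (Pi.single t 1)
  refine ext_of_integral_monom fun b _ => ?_
  rw [integral_monom_nextGeneration, monom, Finset.prod_eq_single t]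
  · simp
  · intro s _ hs
    simp [hs]
  · simp

/-! ### The offspring law -/

/-- On each antidiagonal the binomial theorem gives `(x + y) ^ n`, and these form a geometric
series. Absolute convergence justifies the grouping. -/
theorem hasSum_choose_mul_pow {x y : ℂ} (h : ‖x‖ + ‖y‖ < 1) :
    HasSum (fun c : ℕ × ℕ => ((c.1 + c.2).choose c.1 : ℂ) * x ^ c.1 * y ^ c.2) (1 - x - y)⁻¹ := by
  have hanti (x y : ℂ) (n : ℕ) : ∑ c ∈ Finset.HasAntidiagonal.antidiagonal n,
      ((c.1 + c.2).choose c.1 : ℂ) * x ^ c.1 * y ^ c.2 = (x + y) ^ n := by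
    rw [(Commute.all x y).add_pow']
    refine Finset.sum_congr rfl fun c hc => ?_
    rw [Finset.HasAntidiagonal.mem_antidiagonal.1 hc, nsmul_eq_mul, mul_assoc]
  have hantiR (x y : ℝ) (n : ℕ) : ∑ c ∈ Finset.HasAntidiagonal.antidiagonal n,
      ((c.1 + c.2).choose c.1 : ℝ) * x ^ c.1 * y ^ c.2 = (x + y) ^ n := by
    exact_mod_cast hanti x y n
  set f : ℕ × ℕ → ℂ := fun c => ((c.1 + c.2).choose c.1 : ℂ) * x ^ c.1 * y ^ c.2 with hf
  have hs : Summable fun p : (Σ n : ℕ, Finset.HasAntidiagonal.antidiagonal n) => f p.2 := by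
    refine Summable.of_norm ?_
    rw [summable_sigma_of_nonneg fun _ => norm_nonneg _]
    refine ⟨fun n => Summable.of_finite, ?_⟩
    have hn (n : ℕ) : ∑' c : Finset.HasAntidiagonal.antidiagonal n, ‖f c‖ = (‖x‖ + ‖y‖) ^ n := by
      rw [Finset.tsum_subtype (Finset.HasAntidiagonal.antidiagonal n) fun c => ‖f c‖, ← hantiR]
      simp [hf]
    simp only [hn]
    exact summable_geometric_of_lt_one (by positivity) h
  have hg : HasSum (fun n : ℕ => (x + y) ^ n) (1 - (x + y))⁻¹ :=
    hasSum_geometric_of_norm_lt_one ((norm_add_le x y).trans_lt h)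
  have h1 := hs.hasSum.sigma fun n => (Finset.hasSum (Finset.HasAntidiagonal.antidiagonal n) f)
  simp only [hf, hanti] at h1
  have h2 := hs.hasSum
  rw [h1.unique hg, ← sub_sub] at h2
  exact Finset.HasAntidiagonal.sigmaAntidiagonalEquivProd.hasSum_iff.1 h2

theorem norm_alp_add_norm_bet_lt {ω : Env} (hq : ∀ i, 0 < q ω i) (hp₁ : ∀ i, 0 < p₁ ω i)
    (hp₂ : ∀ i, 0 < p₂ ω i) (i : ℤ) {b : Fin 3 → ℂ} (hb : ∀ t, ‖b t‖ ≤ 1) :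
    ‖alp ω i * b 0‖ + ‖bet ω i * b 1‖ < 1 := by
  obtain ⟨ha, hb'⟩ := alp_bet_pos hq hp₁ hp₂ i
  have h := one_sub_alp_bet_pos hp₁ i
  rw [norm_mul, norm_mul, Complex.norm_real, Complex.norm_real, Real.norm_of_nonneg ha.le,
    Real.norm_of_nonneg hb'.le]
  have := mul_le_of_le_one_right ha.le (hb 0)
  have := mul_le_of_le_one_right hb'.le (hb 1)
  linarith

/-- The generating function of the offspring law. -/
noncomputable def offGen (ω : Env) (i : ℤ) (b : Fin 3 → ℂ) (t : Fin 3) : ℂ :=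
  (1 - alp ω i - bet ω i) * (1 - alp ω i * b 0 - bet ω i * b 1)⁻¹ * if t = 1 then b 2 else 1

theorem integral_monom_offspringLaw {ω : Env} (hq : ∀ i, 0 < q ω i) (hp₁ : ∀ i, 0 < p₁ ω i)
    (hp₂ : ∀ i, 0 < p₂ ω i) (i : ℤ) (t : Fin 3) {b : Fin 3 → ℂ} (hb : ∀ t, ‖b t‖ ≤ 1) :
    ∫ v, monom b v ∂offspringLaw ω i t = offGen ω i b t := by
  obtain ⟨ha, hb'⟩ := alp_bet_pos hq hp₁ hp₂ i
  have h := one_sub_alp_bet_pos hp₁ i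
  rw [offspringLaw, integral_sum_dirac fun _ => ENNReal.ofReal_ne_top]
  have hs := ((hasSum_choose_mul_pow (norm_alp_add_norm_bet_lt hq hp₁ hp₂ i hb)).mul_left
    (1 - alp ω i - bet ω i : ℂ)).mul_right (if t = 1 then b 2 else 1)
  rw [offGen, ← hs.tsum_eq]
  refine tsum_congr fun c => ?_
  rw [ENNReal.toReal_ofReal (by positivity), monom, Fin.prod_univ_three, Complex.real_smul]
  push_cast
  split_ifs <;> simp [mul_pow] <;> ring

theorem isProbabilityMeasure_offspringLaw {ω : Env} (hq : ∀ i, 0 < q ω i)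
    (hp₁ : ∀ i, 0 < p₁ ω i) (hp₂ : ∀ i, 0 < p₂ ω i) (i : ℤ) (t : Fin 3) :
    IsProbabilityMeasure (offspringLaw ω i t) := by
  obtain ⟨ha, hb'⟩ := alp_bet_pos hq hp₁ hp₂ i
  have h := one_sub_alp_bet_pos hp₁ i
  have hs := (hasSum_choose_mul_pow (norm_alp_add_norm_bet_lt hq hp₁ hp₂ i
    (b := fun _ => 1) (by simp))).mul_left (1 - alp ω i - bet ω i : ℂ)
  have hne : (1 - alp ω i - bet ω i : ℂ) ≠ 0 := by exact_mod_cast h.ne'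
  simp only [mul_one] at hs
  rw [mul_inv_cancel₀ hne] at hs
  have hsR : HasSum (fun c : ℕ × ℕ => (1 - alp ω i - bet ω i) * ((c.1 + c.2).choose c.1 : ℝ)
      * alp ω i ^ c.1 * bet ω i ^ c.2) 1 := by
    rw [← Complex.hasSum_ofReal]
    push_cast
    simpa only [mul_assoc] using hs
  constructor
  rw [offspringLaw, Measure.sum_apply _ MeasurableSet.univ]
  simp only [Measure.smul_apply, measure_univ, smul_eq_mul, mul_one]
  rw [← ENNReal.ofReal_tsum_of_nonneg (fun c => by positivity) hsR.summable, hsR.tsum_eq,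
    ENNReal.ofReal_one]

theorem offspringLaw_singleton (ω : Env) (i : ℤ) (t : Fin 3) (a b : ℕ) :
    offspringLaw ω i t {![a, b, if t = 1 then 1 else 0]}
      = ENNReal.ofReal ((1 - alp ω i - bet ω i) * ((a + b).choose a : ℝ) * alp ω i ^ a
          * bet ω i ^ b) := by
  rw [offspringLaw, Measure.sum_apply _ (measurableSet_singleton _), tsum_eq_single (a, b)]
  · simp
  · rintro ⟨c, d⟩ hcd
    have : ![c, d, if t = 1 then 1 else 0] ≠ ![a, b, if t = 1 then 1 else 0] := by
      intro h
      refine hcd (Prod.ext ?_ ?_)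
      · exact congrFun h 0
      · exact congrFun h 1
    simp [this]

/-- Absorbed weights must stay in the unit disc, so that all results on `genFun` apply to them
again. -/
theorem norm_offGen_le {ω : Env} (hq : ∀ i, 0 < q ω i) (hp₁ : ∀ i, 0 < p₁ ω i)
    (hp₂ : ∀ i, 0 < p₂ ω i) (i : ℤ) {b : Fin 3 → ℂ} (hb : ∀ t, ‖b t‖ ≤ 1) (t : Fin 3) :
    ‖offGen ω i b t‖ ≤ 1 := by
  have := isProbabilityMeasure_offspringLaw hq hp₁ hp₂ i t
  rw [← integral_monom_offspringLaw hq hp₁ hp₂ i t hb]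
  exact (norm_integral_le_of_norm_le_const (.of_forall (norm_monom_le hb))).trans (by simp)

/-! ### Summing over the lowest level -/

/-- The weights that account for the offspring of the individuals of level `l + 1`. -/
noncomputable def absorb (ω : Env) (l : ℤ) (z : ℤ → Fin 3 → ℂ) : ℤ → Fin 3 → ℂ := fun j t =>
  if j ≤ l then 1 else if j = l + 1 then z j t * offGen ω l (z l) t else z j t

theorem norm_absorb_le {ω : Env} (hq : ∀ i, 0 < q ω i) (hp₁ : ∀ i, 0 < p₁ ω i)
    (hp₂ : ∀ i, 0 < p₂ ω i) (l : ℤ) {z : ℤ → Fin 3 → ℂ} (hz : ∀ j t, ‖z j t‖ ≤ 1) (j : ℤ)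
    (t : Fin 3) : ‖absorb ω l z j t‖ ≤ 1 := by
  unfold absorb
  split_ifs
  · simp
  · rw [norm_mul]
    exact mul_le_one₀ (hz j t) (norm_nonneg _) (norm_offGen_le hq hp₁ hp₂ l (hz l) t)
  · exact hz j t

theorem absorb_of_lt (ω : Env) {l j : ℤ} (h : j < l + 1) (z : ℤ → Fin 3 → ℂ) (t : Fin 3) :
    absorb ω l z j t = 1 := by
  simp [absorb, show j ≤ l by omega]

/-- Below `l` the weights are 1, so the returning excursions have total weight α z(0) + β z(1),
against α + β for the unweighted passage; the quotient of the geometric series is the factor in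
`offGen`. The extra z(2) for `t = 1` is the one child of type 2 that ends such a passage. -/
theorem genFun_bottom {ω : Env} (hp₁ : ∀ i, 0 < p₁ ω i) {l : ℤ} {z : ℤ → Fin 3 → ℂ}
    (hz : ∀ j t, ‖z j t‖ ≤ 1) (hl : ∀ j < l, ∀ t, z j t = 1) (t : Fin 3) :
    genFun ω l z l t = offGen ω l (z l) t * passProb ω l t := by
  have h := genFun_mul hz hl ω l t
  have hne := one_sub_retWt_ne_zero hz (q_lt_one hp₁ l) l
  have hr : retWt ω l z l = alp ω l * z l 0 + bet ω l * z l 1 := by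
    rw [retWt, genFun_of_lt ω (by omega), genFun_of_lt ω (by omega), (alp_bet_eq hp₁ l).1,
      (alp_bet_eq hp₁ l).2]
    push_cast; ring
  have hD : (1 - alp ω l - bet ω l : ℂ) ≠ 0 := by
    exact_mod_cast (one_sub_alp_bet_pos hp₁ l).ne'
  rw [hr] at h hne
  rw [← sub_sub] at h hne
  rw [offGen, passProb_eq hp₁ l t, eq_comm, ← mul_right_inj' hne, mul_comm _ (genFun ω l z l t), h,
    genFun_of_lt ω (by omega)]
  push_cast
  fin_cases t
  · simp; field_simp
  · simp [gam_eq]; field_simp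
  · simp; field_simp

/-- At `i = l + 1` this is `genFun_bottom`. Equality of these products is exactly what
`genFun_congr` needs, and above `l + 1` the two systems of weights coincide, so it propagates
upwards. -/
theorem mul_genFun_absorb {ω : Env} (hq : ∀ i, 0 < q ω i) (hp₁ : ∀ i, 0 < p₁ ω i)
    (hp₂ : ∀ i, 0 < p₂ ω i) {l : ℤ} {z : ℤ → Fin 3 → ℂ}
    (hz : ∀ j t, ‖z j t‖ ≤ 1) (hl : ∀ j < l, ∀ t, z j t = 1) {i : ℤ} (hi : l + 1 ≤ i) (t : Fin 3) :
    z i t * genFun ω l z (i - 1) t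
      = absorb ω l z i t * genFun ω (l + 1) (absorb ω l z) (i - 1) t := by
  induction i, hi using Int.leInduction generalizing t with
  | base =>
    rw [add_sub_cancel_right, genFun_bottom hp₁ hz hl, genFun_of_lt ω (show l < l + 1 by omega),
      absorb, if_neg (by omega), if_pos rfl, mul_assoc]
  | succ i hi ih =>
    rw [add_sub_cancel_right, genFun_congr hz hl (norm_absorb_le hq hp₁ hp₂ l hz)
      (fun j hj => absorb_of_lt ω hj z) (q_lt_one hp₁ i) ih,
      absorb, if_neg (by omega), if_neg (by omega)]

/-! ### The generations -/

theorem U_of_nonpos {i : ℤ} (hi : i ≤ 0) (x : WalkPath) (t : Fin 3) : U i x t = cnt x i t := by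
  simp [U, cnt, hi]

theorem U_one_apply (x : WalkPath) (t : Fin 3) [Decidable (x ∈ passType 0 t)] :
    U 1 x t = if x ∈ passType 0 t then 1 else 0 := by
  have h : x ∈ passType 0 t ↔ LadderStep x (1 + backFrom t) (1 + backTo t) := by simp [passType]
  by_cases hx : x ∈ passType 0 t
  · simp [U, hx, h.1 hx]
  · simp [U, hx, mt h.2 hx]

theorem U_one_of_mem {x : WalkPath} {s : Fin 3} (h : x ∈ passType 0 s) :
    U 1 x = Pi.single s 1 := by
  classical
  ext t
  rw [U_one_apply, Pi.single_apply]
  by_cases hts : t = s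
  · subst hts; simp [h]
  · rw [if_neg hts, if_neg fun h' => hts (passType_disjoint h' h)]

theorem measurable_U {i : ℤ} (hi : i ≤ 1) : Measurable (U i) := by
  classical
  refine measurable_pi_lambda _ fun t => ?_
  rcases Int.le_iff_lt_or_eq.1 hi with h | rfl
  · simp only [U_of_nonpos (show i ≤ 0 by omega)]
    exact measurable_cnt i t
  · simp only [U_one_apply]
    exact Measurable.ite (measurableSet_passType 0 t) measurable_const measurable_const

theorem ae_exists_passType {ω : Env} (hT : ∀ᵐ x ∂quenched ω 0, T₁ x < ⊤) :
    ∀ᵐ x ∂quenched ω 0, ∃ t, x ∈ passType 0 t := by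
  filter_upwards [hT, ae_legal ω 0, quenched_zero ω 0] with x hT hx h0
  obtain ⟨n, hn⟩ := T₁_lt_top_iff.1 hT
  have := exists_passType hx hn
  rwa [h0] at this

theorem monom_U_one {x : WalkPath} {s : Fin 3} (h : x ∈ passType 0 s) (b : Fin 3 → ℂ) :
    monom b (U 1 x) = b s := by
  rw [U_one_of_mem h, monom, Finset.prod_eq_single s]
  · simp
  · intro t _ ht; simp [ht]
  · simp

/-- The joint generating function of the generations. -/
theorem integral_prod_monom_U {ω : Env} (hT : ∀ᵐ x ∂quenched ω 0, T₁ x < ⊤) {l : ℤ} (hl : l ≤ 1)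
    {z : ℤ → Fin 3 → ℂ} (hz : ∀ j t, ‖z j t‖ ≤ 1) :
    ∫ x, ∏ j ∈ Finset.Icc l 1, monom (z j) (U j x) ∂quenched ω 0
      = ∑ t, z 1 t * genFun ω l z 0 t := by
  have hint (t : Fin 3) : Integrable (fun x => z 1 t * passWt l z 0 t x) (quenched ω 0) :=
    (integrable_of_norm_le_one (measurable_passWt _ _ _ _) (norm_passWt_le hz _ _ _)).const_mul _
  simp only [← integral_passWt, ← integral_const_mul]
  rw [← integral_finsetSum _ fun t _ => hint t]
  refine integral_congr_ae ?_
  filter_upwards [ae_exists_passType hT] with x hx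
  obtain ⟨s, hs⟩ := hx
  have hI : Finset.Icc l 1 = insert 1 (Finset.Icc l 0) := by
    ext j; simp only [Finset.mem_Icc, Finset.mem_insert]; omega
  rw [hI, Finset.prod_insert (by simp), monom_U_one hs, Finset.sum_eq_single s, passWt_of_mem l z hs]
  · congr 1
    refine Finset.prod_congr rfl fun j hj => ?_
    simp only [monom, U_of_nonpos (Finset.mem_Icc.1 hj).2]
  · intro t _ ht
    rw [passWt_of_mem_of_ne hs (Ne.symm ht), mul_zero]
  · simp

theorem integral_prod_monom_U_absorb {ω : Env} (hq : ∀ i, 0 < q ω i) (hp₁ : ∀ i, 0 < p₁ ω i)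
    (hp₂ : ∀ i, 0 < p₂ ω i) (hT : ∀ᵐ x ∂quenched ω 0, T₁ x < ⊤) {l : ℤ} (hl : l ≤ 0)
    {z : ℤ → Fin 3 → ℂ} (hz : ∀ j t, ‖z j t‖ ≤ 1) (hl1 : ∀ j < l, ∀ t, z j t = 1) :
    ∫ x, ∏ j ∈ Finset.Icc l 1, monom (z j) (U j x) ∂quenched ω 0
      = ∫ x, ∏ j ∈ Finset.Icc (l + 1) 1, monom (absorb ω l z j) (U j x) ∂quenched ω 0 := by
  rw [integral_prod_monom_U hT (by omega) hz,
    integral_prod_monom_U hT (by omega) (norm_absorb_le hq hp₁ hp₂ l hz)]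
  exact Finset.sum_congr rfl fun t _ => mul_genFun_absorb hq hp₁ hp₂ hz hl1 (by omega) t

/-- The generations `0, …, n`. -/
noncomputable def firstGens (n : ℕ) (x : WalkPath) : Fin (n + 1) → Fin 3 → ℕ := fun k => U (1 - k) x

theorem measurable_firstGens (n : ℕ) : Measurable (firstGens n) :=
  measurable_pi_lambda _ fun k => measurable_U (by omega)

/-- The law of the generation `n + 1`, given the generations `0, …, n`. -/
noncomputable def genKernel (ω : Env) (n : ℕ) : Kernel (Fin (n + 1) → Fin 3 → ℕ) (Fin 3 → ℕ) :=
  Kernel.ofFunOfCountable fun s => nextGeneration (offspringLaw ω (-n)) (s (Fin.last n))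

theorem genKernel_apply (ω : Env) (n : ℕ) (s : Fin (n + 1) → Fin 3 → ℕ) :
    genKernel ω n s = nextGeneration (offspringLaw ω (-n)) (s (Fin.last n)) := rfl

theorem prod_Icc_one_eq {R : Type*} [CommMonoid R] (f : ℤ → R) (n : ℕ) :
    ∏ j ∈ Finset.Icc (1 - n : ℤ) 1, f j = ∏ k ∈ Finset.range (n + 1), f (1 - k) := by
  refine (Finset.prod_nbij' (fun k : ℕ => (1 - k : ℤ)) (fun j => (1 - j).toNat) ?_ ?_ ?_ ?_ ?_).symm
  · intro k hk
    simp only [Finset.mem_range, Finset.mem_Icc] at hk ⊢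
    omega
  · intro j hj
    simp only [Finset.mem_range, Finset.mem_Icc] at hj ⊢
    omega
  · intro k hk
    omega
  · intro j hj
    simp only [Finset.mem_Icc] at hj
    omega
  · intro k hk
    rfl

theorem monom_mul_monom {ι : Type*} [Fintype ι] (b c : ι → ℂ) (v : ι → ℕ) :
    monom b v * monom c v = monom (fun t => b t * c t) v := by
  simp only [monom, ← Finset.prod_mul_distrib, mul_pow]

/-- The joint law of the generations `0, …, n + 1`. -/
theorem map_generations {ω : Env} (hq : ∀ i, 0 < q ω i) (hp₁ : ∀ i, 0 < p₁ ω i)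
    (hp₂ : ∀ i, 0 < p₂ ω i) (hT : ∀ᵐ x ∂quenched ω 0, T₁ x < ⊤) (n : ℕ) :
    (quenched ω 0).map (fun x => (firstGens n x, U (-n) x))
      = ((quenched ω 0).map (firstGens n)) ⊗ₘ genKernel ω n := by
  have hoff (t : Fin 3) := isProbabilityMeasure_offspringLaw hq hp₁ hp₂ (-n) t
  have hκ : IsMarkovKernel (genKernel ω n) := ⟨fun s => by
    rw [genKernel_apply]; exact isProbabilityMeasure_nextGeneration _⟩
  have hfg := measurable_firstGens n
  have hUm : Measurable (U (-n)) := measurable_U (by omega)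
  have : IsProbabilityMeasure ((quenched ω 0).map (firstGens n)) :=
    Measure.isProbabilityMeasure_map hfg.aemeasurable
  refine ext_of_integral_monom_mul fun b hb => ?_
  have hFm : Measurable fun p : (Fin (n + 1) → Fin 3 → ℕ) × (Fin 3 → ℕ) =>
      (∏ k : Fin (n + 1), monom (b k) (p.1 k)) * monom (b (n + 1)) p.2 :=
    measurable_of_countable _
  have hFn (p : (Fin (n + 1) → Fin 3 → ℕ) × (Fin 3 → ℕ)) :
      ‖(∏ k : Fin (n + 1), monom (b k) (p.1 k)) * monom (b (n + 1)) p.2‖ ≤ 1 := by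
    rw [norm_mul, norm_prod]
    exact mul_le_one₀ (Finset.prod_le_one (fun _ _ => norm_nonneg _)
      fun k _ => norm_monom_le (hb k) _) (norm_nonneg _) (norm_monom_le (hb _) _)
  -- Generation `k` sits at level `1 - k`; the new generation `n + 1` is the lowest weighted level,
  -- `-n`.
  set z : ℤ → Fin 3 → ℂ := fun j => if -(n : ℤ) ≤ j then b (1 - j).toNat else fun _ => 1 with hz
  have hz1 (j : ℤ) (t : Fin 3) : ‖z j t‖ ≤ 1 := by
    simp only [hz]; split_ifs
    · exact hb _ t
    · simp
  have hzl : ∀ j < -(n : ℤ), ∀ t, z j t = 1 := by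
    intro j hj t; simp [hz, not_le.2 hj]
  have hzb (k : ℕ) (hk : k ≤ n + 1) : z (1 - k) = b k := by
    simp only [hz]
    rw [if_pos (by omega)]
    congr 1
    omega
  have key := integral_prod_monom_U_absorb hq hp₁ hp₂ hT (l := -n) (by omega) hz1 hzl
  rw [integral_map (hfg.prodMk hUm).aemeasurable hFm.aestronglyMeasurable,
    Measure.integral_compProd (integrable_of_norm_le_one hFm hFn)]
  simp only [integral_const_mul, genKernel_apply, integral_monom_nextGeneration,
    integral_monom_offspringLaw hq hp₁ hp₂ _ _ (hb (n + 1))]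
  rw [integral_map hfg.aemeasurable (measurable_of_countable _).aestronglyMeasurable]
  convert key using 1
  · refine integral_congr_ae (.of_forall fun x => ?_)
    have h1 := prod_Icc_one_eq (fun j => monom (z j) (U j x)) (n + 1)
    rw [show (1 - (n + 1 : ℕ) : ℤ) = -n by push_cast; ring] at h1
    simp only
    rw [h1, Finset.prod_range_succ, hzb (n + 1) le_rfl,
      show (1 - (n + 1 : ℕ) : ℤ) = -n by push_cast; ring, ← Fin.prod_univ_eq_prod_range
        (fun k => monom (z (1 - k)) (U (1 - k) x))]
    congr 1
    refine Finset.prod_congr rfl fun k _ => ?_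
    rw [hzb k (by omega)]
    rfl
  · refine integral_congr_ae (.of_forall fun x => ?_)
    have h1 := prod_Icc_one_eq (fun j => monom (absorb ω (-n) z j) (U j x)) n
    rw [show (1 - n : ℤ) = -n + 1 by ring] at h1
    simp only
    rw [h1, Finset.prod_range_succ, ← Fin.prod_univ_eq_prod_range
        (fun k => monom (absorb ω (-n) z (1 - k)) (U (1 - k) x)), Fin.prod_univ_castSucc, mul_assoc]
    congr 1
    · refine Finset.prod_congr rfl fun k _ => ?_
      have hk := k.2
      have : absorb ω (-n) z (1 - (k : ℕ)) = b k := by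
        ext t
        rw [absorb, if_neg (by omega), if_neg (by omega), hzb k (by omega)]
      simp only [Fin.val_castSucc, firstGens, this]
    -- Only the parents' level `1 - n` changes its weights, gaining the offspring generating
    -- function; this matches the integral against `genKernel`.
    · have : absorb ω (-n) z (1 - n) = fun t => b n t * offGen ω (-n) (b (n + 1)) t := by
        ext t
        have h2 := hzb (n + 1) le_rfl
        rw [show (1 - (n + 1 : ℕ) : ℤ) = -n by push_cast; ring] at h2
        rw [absorb, if_neg (by omega), if_pos (by omega), hzb n (by omega), h2]
      rw [this, ← monom_mul_monom]
      rfl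

theorem vec_eq_single (t : Fin 3) :
    ![![1, 0, 0], ![0, 1, 0], ![0, 0, 1]] t = (Pi.single t 1 : Fin 3 → ℕ) := by
  revert t; decide

theorem measure_U_one {ω : Env} (hp₁ : ∀ i, 0 < p₁ ω i) (hT : ∀ᵐ x ∂quenched ω 0, T₁ x < ⊤)
    (t : Fin 3) : (quenched ω 0).real {x | U 1 x = Pi.single t 1}
      = ![p₁ ω 0, gam ω 0, p₂ ω 0] t / (1 - alp ω 0 - bet ω 0) := by
  rw [← passProb_eq hp₁, passProb]
  refine measureReal_congr ?_
  filter_upwards [ae_exists_passType hT] with x hx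
  obtain ⟨s, hs⟩ := hx
  refine propext ⟨fun h => ?_, fun h => U_one_of_mem h⟩
  have h : U 1 x = Pi.single t 1 := h
  rw [U_one_of_mem hs] at h
  have : s = t := by
    by_contra hst
    have := congrFun h s
    simp [hst] at this
  exact this ▸ hs

theorem map_U_one {ω : Env} (hp₁ : ∀ i, 0 < p₁ ω i) (hT : ∀ᵐ x ∂quenched ω 0, T₁ x < ⊤) :
    (quenched ω 0).map (U 1) = immigrationLaw ω := by
  have himm : immigrationLaw ω = Measure.sum fun t : Fin 3 =>
      ENNReal.ofReal (passProb ω 0 t) • Measure.dirac (Pi.single t 1 : Fin 3 → ℕ) := by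
    simp only [Measure.sum_fintype, Fin.sum_univ_three, immigrationLaw, passProb_eq hp₁,
      ← vec_eq_single]
    rfl
  have hfin : IsFiniteMeasure (immigrationLaw ω) := by
    constructor
    rw [himm, Measure.sum_apply _ MeasurableSet.univ, tsum_fintype]
    simp
  have hm : Measurable (U 1) := measurable_U le_rfl
  have : IsProbabilityMeasure ((quenched ω 0).map (U 1)) :=
    Measure.isProbabilityMeasure_map hm.aemeasurable
  refine ext_of_integral_monom fun b hb => ?_
  have h := integral_prod_monom_U hT (l := 1) le_rfl (z := fun _ => b) fun _ => hb
  rw [integral_map hm.aemeasurable (measurable_monom b).aestronglyMeasurable, himm,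
    integral_sum_dirac fun _ => ENNReal.ofReal_ne_top, tsum_fintype]
  simp only [Finset.Icc_self, Finset.prod_singleton] at h
  rw [h]
  refine Finset.sum_congr rfl fun t _ => ?_
  rw [genFun_of_lt ω (by norm_num), ENNReal.toReal_ofReal (passProb_nonneg _ _ _), mul_comm,
    Complex.real_smul, monom, Finset.prod_eq_single t]
  · simp
  · intro s _ hs; simp [hs]
  · simp

theorem isBranchingProcess_U {ω : Env} (hq : ∀ i, 0 < q ω i) (hp₁ : ∀ i, 0 < p₁ ω i)
    (hp₂ : ∀ i, 0 < p₂ ω i) (hT : ∀ᵐ x ∂quenched ω 0, T₁ x < ⊤) :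
    IsBranchingProcess (quenched ω 0) (fun n => U (1 - n)) (immigrationLaw ω)
      (fun n => offspringLaw ω (-n)) where
  measurable n := measurable_U (by omega)
  isProbabilityMeasure_imm := by
    rw [← map_U_one hp₁ hT]
    exact Measure.isProbabilityMeasure_map (measurable_U le_rfl).aemeasurable
  isProbabilityMeasure_off n t := isProbabilityMeasure_offspringLaw hq hp₁ hp₂ _ t
  map_zero := by simpa using map_U_one hp₁ hT
  measure_succ n u := by
    have hoff (t : Fin 3) := isProbabilityMeasure_offspringLaw hq hp₁ hp₂ (-n) t
    have hκ : IsMarkovKernel (genKernel ω n) := ⟨fun s => by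
      rw [genKernel_apply]; exact isProbabilityMeasure_nextGeneration _⟩
    have hfg := measurable_firstGens n
    have hUm : Measurable (U (-n)) := measurable_U (by omega)
    set a : Fin (n + 1) → Fin 3 → ℕ := fun k => u k with ha
    have h := congrArg (fun ρ => ρ ({a} ×ˢ {u (n + 1)})) (map_generations hq hp₁ hp₂ hT n)
    rw [Measure.map_apply (hfg.prodMk hUm) .of_discrete,
      Measure.compProd_apply_prod .of_discrete .of_discrete, lintegral_singleton,
      Measure.map_apply hfg .of_discrete, genKernel_apply, mul_comm] at h
    have ea (x : WalkPath) : firstGens n x = a ↔ ∀ k ≤ n, U (1 - k) x = u k := by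
      rw [funext_iff]
      exact ⟨fun h1 k hk => h1 ⟨k, by omega⟩, fun h1 k => h1 k (by omega)⟩
    have e1 : (fun x => (firstGens n x, U (-n) x)) ⁻¹' ({a} ×ˢ {u (n + 1)})
        = {s | ∀ k ≤ n + 1, U (1 - k) s = u k} := by
      ext x
      have en : (1 - (n + 1 : ℕ) : ℤ) = -n := by push_cast; ring
      simp only [Set.mem_preimage, Set.mem_prod, Set.mem_singleton_iff, Set.mem_ofPred_eq, ea,
        Nat.le_succ_iff, or_imp, forall_and, forall_eq, en]
    have e2 : firstGens n ⁻¹' {a} = {s | ∀ k ≤ n, U (1 - k) s = u k} := Set.ext ea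
    rw [e1, e2] at h
    exact h

/-- The joint law of two consecutive generations, if the first one is a single individual. -/
theorem measure_single_inter {ω : Env} (hq : ∀ i, 0 < q ω i) (hp₁ : ∀ i, 0 < p₁ ω i)
    (hp₂ : ∀ i, 0 < p₂ ω i) (hT : ∀ᵐ x ∂quenched ω 0, T₁ x < ⊤) {i : ℤ} (hi : i ≤ 0) (t : Fin 3)
    (v : Fin 3 → ℕ) :
    quenched ω 0 ({x | U (i + 1) x = Pi.single t 1} ∩ {x | U i x = v})
      = quenched ω 0 {x | U (i + 1) x = Pi.single t 1} * offspringLaw ω i t {v} := by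
  obtain ⟨n, rfl⟩ : ∃ n : ℕ, i = -n := ⟨i.natAbs, by omega⟩
  have hoff (t : Fin 3) := isProbabilityMeasure_offspringLaw hq hp₁ hp₂ (-n) t
  have hκ : IsMarkovKernel (genKernel ω n) := ⟨fun s => by
    rw [genKernel_apply]; exact isProbabilityMeasure_nextGeneration _⟩
  have hfg := measurable_firstGens n
  have hUm : Measurable (U (-n)) := measurable_U (by omega)
  set A : Set (Fin (n + 1) → Fin 3 → ℕ) := {s | s (Fin.last n) = Pi.single t 1} with hA
  have h := congrArg (fun ρ => ρ (A ×ˢ {v})) (map_generations hq hp₁ hp₂ hT n)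
  rw [Measure.map_apply (hfg.prodMk hUm) .of_discrete,
    Measure.compProd_apply_prod .of_discrete .of_discrete,
    setLIntegral_congr_fun (g := fun _ => offspringLaw ω (-n) t {v}) .of_discrete,
    setLIntegral_const, Measure.map_apply hfg .of_discrete, mul_comm] at h
  · have e (x : WalkPath) : firstGens n x ∈ A ↔ U (-n + 1) x = Pi.single t 1 := by
      simp only [hA, firstGens, Set.mem_ofPred_eq, Fin.val_last]
      rw [show (-n + 1 : ℤ) = 1 - n by ring]
    have e1 : (fun x => (firstGens n x, U (-n) x)) ⁻¹' (A ×ˢ {v})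
        = {x | U (-n + 1) x = Pi.single t 1} ∩ {x | U (-n) x = v} := by
      ext x
      simp [e]
    have e2 : firstGens n ⁻¹' A = {x | U (-n + 1) x = Pi.single t 1} := by
      ext x
      simp [e]
    rwa [e1, e2] at h
  · intro s hs
    have hs' : s (Fin.last n) = Pi.single t 1 := hs
    simp only [genKernel_apply, hs', nextGeneration_single]

/-- It justifies conditioning: events of mass zero would make the conditional laws vanish. -/
theorem measure_single_pos {ω : Env} (hq : ∀ i, 0 < q ω i) (hp₁ : ∀ i, 0 < p₁ ω i)
    (hp₂ : ∀ i, 0 < p₂ ω i) (hT : ∀ᵐ x ∂quenched ω 0, T₁ x < ⊤) (n : ℕ) (t : Fin 3) :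
    quenched ω 0 {x | U (1 - n) x = Pi.single t 1} ≠ 0 := by
  induction n generalizing t with
  | zero =>
    intro h
    have h1 := measure_U_one hp₁ hT t
    rw [← passProb_eq hp₁, Measure.real] at h1
    simp only [Nat.cast_zero, sub_zero] at h
    rw [h] at h1
    exact (passProb_pos hq hp₁ hp₂ 0 t).ne h1
  | succ n ih =>
    obtain ⟨ha, hb⟩ := alp_bet_pos hq hp₁ hp₂ (-n)
    have hD := one_sub_alp_bet_pos hp₁ (-n)
    have hstep (s : Fin 3) (c d : ℕ)
        (he : ![c, d, if s = 1 then 1 else 0] = (Pi.single t 1 : Fin 3 → ℕ)) :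
        quenched ω 0 {x | U (1 - (n + 1 : ℕ)) x = Pi.single t 1} ≠ 0 := by
      have h1 := measure_single_inter hq hp₁ hp₂ hT (i := -n) (by omega) s
        ![c, d, if s = 1 then 1 else 0]
      rw [offspringLaw_singleton, show (-n + 1 : ℤ) = 1 - n by ring, he] at h1
      have h2 : (c + d).choose c ≠ 0 := (Nat.choose_pos (Nat.le_add_right c d)).ne'
      rw [show (1 - (n + 1 : ℕ) : ℤ) = -n by push_cast; ring]
      intro h0
      rw [measure_mono_null Set.inter_subset_right h0] at h1
      refine mul_ne_zero (ih s) ?_ h1.symm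
      rw [ne_eq, ENNReal.ofReal_eq_zero, not_le]
      positivity
    -- A single child of type 0 or 1 can come from a parent of type 0. A child of type 2 comes only
    -- from a parent of type 1, here with no other children.
    fin_cases t
    · exact hstep 0 1 0 (by decide)
    · exact hstep 0 0 1 (by decide)
    · exact hstep 1 0 0 (by decide)

theorem cond_offspring {ω : Env} (hq : ∀ i, 0 < q ω i) (hp₁ : ∀ i, 0 < p₁ ω i)
    (hp₂ : ∀ i, 0 < p₂ ω i) (hT : ∀ᵐ x ∂quenched ω 0, T₁ x < ⊤) {i : ℤ} (hi : i ≤ 0) (t : Fin 3)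
    (a b : ℕ) :
    ((quenched ω 0)[|{x | U (i + 1) x = Pi.single t 1}]).real
        {x | U i x = ![a, b, if t = 1 then 1 else 0]}
      = (1 - alp ω i - bet ω i) * ((a + b).choose a : ℝ) * alp ω i ^ a * bet ω i ^ b := by
  obtain ⟨ha, hb⟩ := alp_bet_pos hq hp₁ hp₂ i
  have hD := one_sub_alp_bet_pos hp₁ i
  have hm : MeasurableSet {x | U (i + 1) x = Pi.single t 1} :=
    measurable_U (by omega) (measurableSet_singleton _)
  have hpos := measure_single_pos hq hp₁ hp₂ hT (-i).toNat t
  rw [show (1 - ((-i).toNat : ℤ)) = i + 1 by omega] at hpos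
  rw [Measure.real, cond_apply hm, measure_single_inter hq hp₁ hp₂ hT hi, ← mul_assoc,
    ENNReal.inv_mul_cancel hpos (measure_ne_top _ _), one_mul, offspringLaw_singleton,
    ENNReal.toReal_ofReal (by positivity)]

/-! ### Transience and ellipticity at all sites -/

/-- Paths that are not bounded above. -/
def unboundedAbove : Set WalkPath := {x | ∀ B : ℤ, ∃ n, B < x n}

theorem measurableSet_unboundedAbove : MeasurableSet unboundedAbove := by
  unfold unboundedAbove
  measurability

theorem unboundedAbove_after {x : WalkPath} (hx : x ∈ unboundedAbove) :
    after 1 x ∈ unboundedAbove := by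
  intro B
  obtain ⟨n, hn⟩ := hx (max B (x 0))
  obtain ⟨m, rfl⟩ : ∃ m, n = m + 1 := Nat.exists_eq_succ_of_ne_zero fun h => by
    rw [h] at hn
    exact absurd (le_max_right B (x 0)) (not_le.2 hn)
  exact ⟨m, by rw [after_apply, add_comm]; exact (le_max_left _ _).trans_lt hn⟩

theorem T₁_lt_top_of_unboundedAbove {x : WalkPath} (hx : x ∈ unboundedAbove) : T₁ x < ⊤ := by
  obtain ⟨n, hn⟩ := hx (x 0)
  exact T₁_lt_top_iff.2 (exists_firstPass hn)

/-- Dropping the first step keeps a path unbounded above. A positive probability of failure from `c`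
would, by the Markov property, give one from `k`. -/
theorem ae_unboundedAbove_step {ω : Env} {k c : ℤ} (hc : stepLaw ω k {c} ≠ 0)
    (h : ∀ᵐ x ∂quenched ω k, x ∈ unboundedAbove) : ∀ᵐ x ∂quenched ω c, x ∈ unboundedAbove := by
  set y : WalkPath := fun m => if m = 0 then k else c with hy
  have hcyl : quenched ω k {x | ∀ m ≤ 1, x m = y m} ≠ 0 := by
    rw [show (1 : ℕ) = 0 + 1 from rfl, quenched_cylinder_succ, quenched_cylinder_zero]
    simpa [hy] using hc
  have h1 := congrArg (fun ρ => ρ unboundedAboveᶜ) (markov_cylinder ω k 1 y)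
  simp only [Measure.smul_apply, smul_eq_mul] at h1
  rw [Measure.map_apply (measurable_after 1) measurableSet_unboundedAbove.compl] at h1
  have h2 : (quenched ω k).restrict {x | ∀ m ≤ 1, x m = y m} (after 1 ⁻¹' unboundedAboveᶜ) = 0 := by
    refine le_antisymm ((Measure.restrict_apply_le _ _).trans ?_) zero_le
    exact (measure_mono_null (t := {x | ¬ x ∈ unboundedAbove})
      (fun x (hx : after 1 x ∉ unboundedAbove) hx' => hx (unboundedAbove_after hx')) h).le
  rw [h2, eq_comm, mul_eq_zero] at h1
  exact h1.resolve_left hcyl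

theorem ae_unboundedAbove {ω : Env} (hq : ∀ i, 0 < q ω i) (hp₁ : ∀ i, 0 < p₁ ω i)
    (h : ∀ᵐ x ∂quenched ω 0, x ∈ unboundedAbove) (i : ℤ) :
    ∀ᵐ x ∂quenched ω i, x ∈ unboundedAbove := by
  induction i using Int.induction_on with
  | zero => exact h
  | succ i ih =>
    refine ae_unboundedAbove_step ?_ ih
    simp [stepLaw, hp₁]
  | pred i ih =>
    refine ae_unboundedAbove_step ?_ ih
    simp [stepLaw, hq]

theorem ae_elliptic {P : Measure Env} [IsProbabilityMeasure P] (hP : MeasurePreserving shift P P)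
    (h : ∀ᵐ ω ∂P, 0 < q ω 0 ∧ 0 < p₁ ω 0 ∧ 0 < p₂ ω 0) :
    ∀ᵐ ω ∂P, ∀ i, 0 < q ω i ∧ 0 < p₁ ω i ∧ 0 < p₂ ω i := by
  rw [ae_all_iff]
  set G : ℤ → Set Env := fun i => {ω | 0 < q ω i ∧ 0 < p₁ ω i ∧ 0 < p₂ ω i} with hG
  have hGm (i : ℤ) : MeasurableSet (G i) := by
    have hc (j : Fin 3) : Measurable fun ω : Env => (ω i).1 j :=
      (measurable_pi_apply j).comp (measurable_subtype_coe.comp (measurable_pi_apply i))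
    exact (measurableSet_lt measurable_const (hc 0)).inter
      ((measurableSet_lt measurable_const (hc 1)).inter (measurableSet_lt measurable_const (hc 2)))
  -- `G (i + 1)` is the preimage of `G i` under the shift; equality of the masses allows induction
  -- in both directions.
  have hstep (i : ℤ) : P (G (i + 1))ᶜ = P (G i)ᶜ :=
    hP.measure_preimage (hGm i).compl.nullMeasurableSet
  intro i
  change P (G i)ᶜ = 0
  induction i using Int.induction_on with
  | zero => exact h
  | succ i ih => rw [hstep, ih]
  | pred i ih =>
    have := hstep (-i - 1)
    rw [sub_add_cancel, ih] at this
    exact this.symm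

end RWRE

theorem theorem1p1 (P : Measure Env) [IsProbabilityMeasure P] (hP : Ergodic shift P)
    (hell : ∃ ε : ℝ, 0 < ε ∧
      ∀ᵐ ω ∂P, 0 < q ω 0 ∧ ε ≤ p₁ ω 0 / q ω 0 ∧ ε ≤ p₂ ω 0 / q ω 0)
    (htrans : ∀ᵐ z ∂annealed P, Tendsto z.2 atTop atTop) :
    ∀ᵐ ω ∂P,
      (∀ᵐ x ∂quenched ω 0, T₁ x < ⊤) ∧
      IsBranchingProcess (quenched ω 0) (fun n => U (1 - n)) (immigrationLaw ω)
        (fun n => offspringLaw ω (-n)) ∧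
      (quenched ω 0).real {x | U 1 x = ![1, 0, 0]} = p₁ ω 0 / (1 - alp ω 0 - bet ω 0) ∧
      (quenched ω 0).real {x | U 1 x = ![0, 1, 0]} = gam ω 0 / (1 - alp ω 0 - bet ω 0) ∧
      (quenched ω 0).real {x | U 1 x = ![0, 0, 1]} = p₂ ω 0 / (1 - alp ω 0 - bet ω 0) ∧
      (∀ i : ℤ, i ≤ 0 → ∀ a b : ℕ,
        ((quenched ω 0)[|{x | U (i + 1) x = ![1, 0, 0]}]).real {x | U i x = ![a, b, 0]}
          = (1 - alp ω i - bet ω i) * ((a + b).choose a : ℝ) * alp ω i ^ a * bet ω i ^ b ∧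
        ((quenched ω 0)[|{x | U (i + 1) x = ![0, 1, 0]}]).real {x | U i x = ![a, b, 1]}
          = (1 - alp ω i - bet ω i) * ((a + b).choose a : ℝ) * alp ω i ^ a * bet ω i ^ b ∧
        ((quenched ω 0)[|{x | U (i + 1) x = ![0, 0, 1]}]).real {x | U i x = ![a, b, 0]}
          = (1 - alp ω i - bet ω i) * ((a + b).choose a : ℝ) * alp ω i ^ a * bet ω i ^ b) ∧
      (∀ i : ℤ,
        (∀ n : ℕ,
          exitProbBefore ω i (i - n) i (i + 1)
            = (sumM ω i n 0 0 - sumM ω i n 0 1) / (1 + sumM ω i n 0 0) ∧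
          exitProbBefore ω i (i - n) i (i + 2)
            = sumM ω i n 0 1 / (1 + sumM ω i n 0 0)) ∧
        Tendsto (fun n : ℕ => exitProbBefore ω i (i - n) i (i + 1)) atTop
          (𝓝 (exitProb ω i i (i + 1))) ∧
        Tendsto (fun n : ℕ => exitProbBefore ω i (i - n) i (i + 2)) atTop
          (𝓝 (exitProb ω i i (i + 2))) ∧
        exitProb ω i i (i + 1) + exitProb ω i i (i + 2) = 1) := by
  obtain ⟨ε, hε, hell⟩ := hell
  have hell0 : ∀ᵐ ω ∂P, 0 < q ω 0 ∧ 0 < p₁ ω 0 ∧ 0 < p₂ ω 0 := by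
    filter_upwards [hell] with ω hω
    obtain ⟨h1, h2, h3⟩ := hω
    rw [le_div_iff₀ h1] at h2 h3
    exact ⟨h1, (mul_pos hε h1).trans_le h2, (mul_pos hε h1).trans_le h3⟩
  have htr : ∀ᵐ ω ∂P, ∀ᵐ x ∂quenched ω 0, Tendsto x atTop atTop := by
    rw [annealed] at htrans
    have h := Measure.ae_ae_of_ae_compProd
      (p := fun z : Env × WalkPath => Tendsto z.2 atTop atTop) htrans
    exact h
  filter_upwards [ae_elliptic hP.toMeasurePreserving hell0, htr] with ω hω hx
  have hq i := (hω i).1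
  have hp₁ i := (hω i).2.1
  have hp₂ i := (hω i).2.2
  -- The hypothesis speaks of the walk from 0 only, but the limits in (b) add up to 1 only if the
  -- walk from each `i` almost surely passes above `i`.
  have hunb : ∀ i, ∀ᵐ x ∂quenched ω i, x ∈ unboundedAbove := by
    refine ae_unboundedAbove hq hp₁ ?_
    filter_upwards [hx] with x hx B
    exact (hx.eventually_gt_atTop B).exists
  have hT (i : ℤ) : ∀ᵐ x ∂quenched ω i, T₁ x < ⊤ :=
    (hunb i).mono fun x => T₁_lt_top_of_unboundedAbove
  have e0 : (![1, 0, 0] : Fin 3 → ℕ) = Pi.single 0 1 := vec_eq_single 0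
  have e1 : (![0, 1, 0] : Fin 3 → ℕ) = Pi.single 1 1 := vec_eq_single 1
  have e2 : (![0, 0, 1] : Fin 3 → ℕ) = Pi.single 2 1 := vec_eq_single 2
  refine ⟨hT 0, isBranchingProcess_U hq hp₁ hp₂ (hT 0), ?_, ?_, ?_, fun i hi a b => ⟨?_, ?_, ?_⟩,
    fun i => ⟨fun n => (exitProbBefore_formula hq (q_lt_one hp₁) n i).2,
      tendsto_exitProbBefore ω i _, tendsto_exitProbBefore ω i _, ?_⟩⟩
  · rw [e0]; exact measure_U_one hp₁ (hT 0) 0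
  · rw [e1]; exact measure_U_one hp₁ (hT 0) 1
  · rw [e2]; exact measure_U_one hp₁ (hT 0) 2
  · rw [e0]; exact cond_offspring hq hp₁ hp₂ (hT 0) hi 0 a b
  · rw [e1]; exact cond_offspring hq hp₁ hp₂ (hT 0) hi 1 a b
  · rw [e2]; exact cond_offspring hq hp₁ hp₂ (hT 0) hi 2 a b
  · rw [exitProb_one, exitProb_two]
    exact sum_passProb (hT i)
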